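/- Let $d\ge 1$, $n\ge 0$, $x_0=(x_{10},\dots,x_{d0})$ with $x_{10}\in\mathbb R$ and $x_{j0}\in[-\infty,\infty)$ for $j\ge2$, and $\mathcal D_0=\{x\in\mathbb R^d: x_j\ge x_{j0}\ \forall j\}$. A measurable set $K\subset\mathcal D_0$ is 1-POU about $x_0$ if $x\in K$ and $x_{10}\le t\le x_1$ imply $(t,x_2,\dots,x_d)\in K$; a probability distribution on $\mathcal D_0$ is 1-POU about $x_0$ if it lies in the closure (for weak convergence) of the convex hull of the uniform distributions on 1-POU sets. Let $S=\{x\in\mathcal D_0: g_1(x_2,\dots,x_d)\le x_1\le g_2(x_2,\dots,x_d)\}$ with measurable $x_{10}\le g_1\le g_2\le\infty$, let $u_{X_1},a_i,b_i\in\mathbb R$, and let $x_{j0}\le\underline x_{ji}\le\bar x_{ji}\le\infty$ for $1\le j\le d$, $1\le i\le n$, with $\underline x_{1i}\in\mathbb R$. For a random vector $X$ in $\mathbb R^d$ with law $P$ put $\bar F(x_0)=P(X\in\mathcal D_0)$. *1-POU-DRO problem* with mass $c$: maximize $P(X\in S)$ over all laws $P$ such that $\bar F(x_0)=c$; there is a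 density $f_{X_1}$ on $[x_{10},\infty)$ of the measure $A\mapsto P(X_1\in A,\,X\in\mathcal D_0)$ which is continuous at $x_{10}$ and satisfies $f_{X_1}(x_{10})\le u_{X_1}$; $a_i\bar F(x_0)\le P(\underline x_{ji}\le X_j\le\bar x_{ji},\ j=1,\dots,d)\le b_i\bar F(x_0)$ for $i=1,\dots,n$; $P(X\in\mathcal D_0)>0$ and the conditional law of $X$ given $X\in\mathcal D_0$ is 1-POU about $x_0$; and $P(X\in\mathcal D_0,\,X_1=x_{10})=0$. *Moment problem* with mass $c$: over probability laws $Q$ of $Z\in\mathcal D_0$, maximize $$c\,E_Q\Big[\tfrac{\min(g_2(Z_2,\dots,Z_d),Z_1)-\min(g_1(Z_2,\dots,Z_d),Z_1)}{Z_1-x_{10}}\Big]$$ subject to $E_Q\big[\tfrac1{Z_1-x_{10}}\big]\le\tfrac{u_{X_1}}c$ (with $1/0=\infty$) and $$a_i\le E_Q\Big[\tfrac{\min(Z_1,\bar x_{1i})-\min(Z_1,\underline x_{1i})}{Z_1-x_{10}}I(\underline x_{ji}\le Z_j\le\bar x_{ji},\ j\ge2)\Big]\le b_i,\quad i=1,\dots,n.$$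 *Nonlinear program* with mass $c$: the same objective and constraints for $Q=\sum_{l=1}^{n+2}p_l\delta_{z_l}$, with decision variables $p_l\ge0$, $\sum_l p_l=1$, and $z_l\in\mathcal D_0$ (with $0\cdot\infty=0$, so a point with $z_{l1}=x_{10}$ must have $p_l=0$). For a law $Q$ on $\mathcal D_0$ let $P_Q$ be the law of $(x_{10}+U(Z_1-x_{10}),Z_2,\dots,Z_d)$, where $Z\sim Q$ and $U$ is uniform on $(0,1)$ and independent of $Z$. Say that $P$ is *recovered* from $(c,Q)$ if $P$ is a probability law on $\mathbb R^d$ whose restriction to $\mathcal D_0$ is $cP_Q$. The optimal value of a problem is the supremum of its objective over the feasible set ($-\infty$ if infeasible), and an optimal solution is a feasible point attaining it. (1) Let $0<c\le1$. The three problems with mass $c$ are equivalent, in the following sense. They have the same optimal value. Every feasible $P$ of the 1-POU-DRO problem is recovered from $(c,Q)$ for some feasible $Q$ of the moment problem; conversely, for each feasible $Q$ there are laws recovered from $(c,Q)$, and all of them are feasible with the same objective value as $Q$. Every feasible $(p,z)$ of the nonlinear program gives a feasible $\sum_lp_l\delta_{z_l}$ of the moment problem with the same objective value, and for every feasible $Q$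 of the moment problem there is a feasible $(p,z)$ whose objective value is at least that of $Q$. If $Q^*$ is optimal for the moment problem, every law recovered from $(c,Q^*)$ is optimal for the 1-POU-DRO problem, and every optimal $P$ of the latter is recovered from $(c,Q^*)$ for some optimal $Q^*$. If $(p^*,z^*)$ is optimal for the nonlinear program, then $\sum_lp^*_l\delta_{z^*_l}$ is optimal for the moment problem; and if the moment problem has an optimal solution, so has the nonlinear program. (2) Let $l_{\bar F},u_{\bar F}\in\mathbb R$ with $u_{\bar F}\le1$. The 1-POU-DRO problem with $\bar F(x_0)=c$ replaced by $l_{\bar F}\le\bar F(x_0)\le u_{\bar F}$ is equivalent to the nonlinear program in which $c$ is an additional decision variable with $c>0$ and $l_{\bar F}\le c\le u_{\bar F}$: the optimal values agree; for every feasible $(c,p,z)$ of the program there are laws recovered from $(c,\sum_lp_l\delta_{z_l})$, and all of them are feasible for the 1-POU-DRO problem with the same objective value; and for every feasible $P$ there are $p,z$ such that $(\bar F(x_0),p,z)$ is feasible with objective value at least that of $P$. If $(c^*,p^*,z^*)$ is optimal for the nonlinear program and $Q^*=\sum_lp_l^*\delta_{z_l^*}$, then laws with restriction $c^*P_{Q^*}$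 to $\mathcal D_0$ exist and all of them are optimal for this 1-POU-DRO problem; and if $P$ is optimal for the latter, there are $p,z$ such that $(\bar F(x_0),p,z)$ is optimal for the nonlinear program. -/

import Mathlib

open MeasureTheory ProbabilityTheory Set
open scoped NNReal ENNReal

noncomputable section

namespace POU

/-! ### Maximization problems -/

/-- A maximization problem: a feasible set and a real objective. -/
structure MaxProblem (α : Type*) where
  feasible : Set α
  objective : α → ℝ

namespace MaxProblem

variable {α : Type*}

/-- The optimal value, in the extended reals (`⊥ = -∞` for an infeasible problem). -/
def value (A : MaxProblem α) : EReal := ⨆ a ∈ A.feasible, (A.objective a : EReal)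

/-- An optimal solution: a feasible point at which the maximum is attained. -/
def IsOptimal (A : MaxProblem α) (a : α) : Prop :=
  a ∈ A.feasible ∧ ∀ b ∈ A.feasible, A.objective b ≤ A.objective a

end MaxProblem

/-! ### Space, tail region and 1-POU distributions -/

/-- `ℝ^d` with `d = m + 1`, written as (first coordinate, remaining coordinates). -/
abbrev Pt (m : ℕ) : Type := ℝ × (Fin m → ℝ)

/-- The tail region `{x ≥ x₀}`, `x₀ = (s, y₀)`, where the entries of `y₀` may be `-∞`. -/
def tail {m : ℕ} (s : ℝ) (y₀ : Fin m → EReal) : Set (Pt m) :=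
  {x | s ≤ x.1 ∧ ∀ j, y₀ j ≤ (x.2 j : EReal)}

/-- 1-POU sets about `x₀ = (s, y₀)`. -/
def IsPOUSet {m : ℕ} (s : ℝ) (y₀ : Fin m → EReal) (K : Set (Pt m)) : Prop :=
  MeasurableSet K ∧ K ⊆ tail s y₀ ∧ ∀ x ∈ K, ∀ t, s ≤ t → t ≤ x.1 → (t, x.2) ∈ K

/-- Uniform distributions on 1-POU sets (of positive and finite Lebesgue measure). -/
def uniformPOU {m : ℕ} (s : ℝ) (y₀ : Fin m → EReal) : Set (Measure (Pt m)) :=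
  {ν | ∃ K, IsPOUSet s y₀ K ∧ volume K ≠ 0 ∧ volume K ≠ ∞ ∧ ν = ProbabilityTheory.cond volume K}

/-- 1-POU distributions about `x₀ = (s, y₀)`: the closure, for weak convergence of probability
measures, of the convex hull of the uniform distributions on 1-POU sets. -/
def IsPOU {m : ℕ} (s : ℝ) (y₀ : Fin m → EReal) (ν : Measure (Pt m)) : Prop :=
  ∃ ν' : ProbabilityMeasure (Pt m), (ν' : Measure (Pt m)) = ν ∧
    ν' ∈ closure {η : ProbabilityMeasure (Pt m) |
      (η : Measure (Pt m)) ∈ convexHull ℝ≥0 (uniformPOU s y₀)}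

/-- The law of `(s + U (Z₁ - s), Z₂, …, Z_d)`, where `Z` has law `Q` and `U` is uniform on `(0,1)`
and independent of `Z`. -/
def mix {m : ℕ} (s : ℝ) (Q : Measure (Pt m)) : Measure (Pt m) :=
  ((volume.restrict (Ioo (0 : ℝ) 1)).prod Q).map
    (fun w : ℝ × Pt m => (s + w.1 * (w.2.1 - s), w.2.2))

/-- The discrete measure with mass `p l` at `z l`. -/
def discrete {m N : ℕ} (p : Fin N → ℝ) (z : Fin N → Pt m) : Measure (Pt m) :=
  ∑ l, ENNReal.ofReal (p l) • Measure.dirac (z l)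

/-- `min(e, t)` for an extended real `e > -∞` and a real `t`. -/
def cap (e : EReal) (t : ℝ) : ℝ := (min e (t : EReal)).toReal

/-! ### The data of the problem -/

/-- The data common to the problems. The mode is `x₀ = (s, y₀)`; the rare-event set is given by
`g₁, g₂`; the `i`-th moment constraint is about the box with lower corner `(lo₁ i, lo i)` and upper
corner `(hi₁ i, hi i)`, with bounds `a i`, `b i`; `uX` bounds the marginal density at `s`. -/
structure Data (m n : ℕ) where
  s : ℝ
  y₀ : Fin m → EReal
  y₀_lt_top : ∀ j, y₀ j < ⊤
  g₁ : (Fin m → ℝ) → EReal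
  g₂ : (Fin m → ℝ) → EReal
  measurable_g₁ : Measurable g₁
  measurable_g₂ : Measurable g₂
  le_g₁ : ∀ y, (∀ j, y₀ j ≤ (y j : EReal)) → (s : EReal) ≤ g₁ y
  g₁_le_g₂ : ∀ y, (∀ j, y₀ j ≤ (y j : EReal)) → g₁ y ≤ g₂ y
  lo₁ : Fin n → ℝ
  hi₁ : Fin n → EReal
  lo : Fin n → Fin m → EReal
  hi : Fin n → Fin m → EReal
  s_le_lo₁ : ∀ i, s ≤ lo₁ i
  lo₁_le_hi₁ : ∀ i, (lo₁ i : EReal) ≤ hi₁ i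
  y₀_le_lo : ∀ i j, y₀ j ≤ lo i j
  lo_le_hi : ∀ i j, lo i j ≤ hi i j
  a : Fin n → ℝ
  b : Fin n → ℝ
  uX : ℝ

namespace Data

variable {m n : ℕ} (D : Data m n)

/-- The tail region `𝒟₀`. -/
def D₀ : Set (Pt m) := tail D.s D.y₀

/-- The rare-event set. -/
def S : Set (Pt m) := {x | x ∈ D.D₀ ∧ D.g₁ x.2 ≤ (x.1 : EReal) ∧ (x.1 : EReal) ≤ D.g₂ x.2}

/-- The condition of the `i`-th box on the coordinates `2, …, d`. -/
def side (i : Fin n) : Set (Pt m) :=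
  {x | ∀ j, D.lo i j ≤ (x.2 j : EReal) ∧ (x.2 j : EReal) ≤ D.hi i j}

/-- The `i`-th box. -/
def box (i : Fin n) : Set (Pt m) :=
  {x | (D.lo₁ i ≤ x.1 ∧ (x.1 : EReal) ≤ D.hi₁ i) ∧ x ∈ D.side i}

/-- `f` is a density, on `[s, ∞)`, of the first coordinate within the tail region, and it is
continuous at `s`. -/
def IsMarginalDensity (P : Measure (Pt m)) (f : ℝ → ℝ≥0∞) : Prop :=
  Measurable f ∧ ContinuousWithinAt f (Ici D.s) D.s ∧
    ∀ A : Set ℝ, MeasurableSet A → A ⊆ Ici D.s →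
      ∫⁻ t in A, f t = P {x | x ∈ D.D₀ ∧ x.1 ∈ A}

/-- The constraints on the law `P` of `X` other than the one on `P(X ≥ x₀)`. -/
def Constraints (P : Measure (Pt m)) : Prop :=
  (∃ f, D.IsMarginalDensity P f ∧ f D.s ≤ ENNReal.ofReal D.uX) ∧
  (∀ i, D.a i * P.real D.D₀ ≤ P.real (D.box i) ∧ P.real (D.box i) ≤ D.b i * P.real D.D₀) ∧
  IsPOU D.s D.y₀ (ProbabilityTheory.cond P D.D₀) ∧
  P {x | x ∈ D.D₀ ∧ x.1 = D.s} = 0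

/-- The 1-POU-DRO problem with the constraint `P(X ≥ x₀) = c`. -/
def dro (c : ℝ) : MaxProblem (Measure (Pt m)) where
  feasible := {P | IsProbabilityMeasure P ∧ P.real D.D₀ = c ∧ D.Constraints P}
  objective P := P.real D.S

/-- The 1-POU-DRO problem with the constraint `l ≤ P(X ≥ x₀) ≤ u`. -/
def droRange (l u : ℝ) : MaxProblem (Measure (Pt m)) where
  feasible := {P | IsProbabilityMeasure P ∧ (l ≤ P.real D.D₀ ∧ P.real D.D₀ ≤ u) ∧ D.Constraints P}
  objective P := P.real D.S

/-- The integrand of the objective. -/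
def objKernel (z : Pt m) : ℝ :=
  (cap (D.g₂ z.2) z.1 - cap (D.g₁ z.2) z.1) / (z.1 - D.s)

/-- The integrand of the `i`-th moment constraint. -/
def momKernel (i : Fin n) (z : Pt m) : ℝ :=
  (cap (D.hi₁ i) z.1 - min z.1 (D.lo₁ i)) / (z.1 - D.s) * (D.side i).indicator 1 z

/-- `1 / (z₁ - s)` for `z₁ ≥ s`, with the value `∞` at `z₁ = s`. -/
def invKernel (z : Pt m) : ℝ≥0∞ := (ENNReal.ofReal (z.1 - D.s))⁻¹

/-- The moment problem; the decision variable is the law `Q` of `Z ∈ 𝒟₀`. -/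
def moment (c : ℝ) : MaxProblem (Measure (Pt m)) where
  feasible := {Q | IsProbabilityMeasure Q ∧ Q D.D₀ = 1 ∧
    ∫⁻ z, D.invKernel z ∂Q ≤ ENNReal.ofReal (D.uX / c) ∧
    ∀ i, D.a i ≤ ∫ z, D.momKernel i z ∂Q ∧ ∫ z, D.momKernel i z ∂Q ≤ D.b i}
  objective Q := c * ∫ z, D.objKernel z ∂Q

/-- The constraints of the nonlinear program at mass `c`, for weights `p l` and points `z l`. In
the first one `1 / 0 = ∞` and `0 · ∞ = 0`, so a point with `z₁ = s` can only carry weight zero. -/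
def NLPConstraints (c : ℝ) (p : Fin (n + 2) → ℝ) (z : Fin (n + 2) → Pt m) : Prop :=
  ∑ l, ENNReal.ofReal (p l) * D.invKernel (z l) ≤ ENNReal.ofReal (D.uX / c) ∧
  (∀ i, D.a i ≤ ∑ l, p l * D.momKernel i (z l) ∧ ∑ l, p l * D.momKernel i (z l) ≤ D.b i) ∧
  ∑ l, p l = 1 ∧ (∀ l, 0 ≤ p l) ∧ ∀ l, z l ∈ D.D₀

/-- The nonlinear program with decision variables `p, z`. -/
def nlp (c : ℝ) : MaxProblem ((Fin (n + 2) → ℝ) × (Fin (n + 2) → Pt m)) where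
  feasible := {w | D.NLPConstraints c w.1 w.2}
  objective w := c * ∑ l, w.1 l * D.objKernel (w.2 l)

/-- The nonlinear program with decision variables `c, p, z`, where `c > 0` and `l ≤ c ≤ u`. -/
def nlpRange (l u : ℝ) : MaxProblem (ℝ × (Fin (n + 2) → ℝ) × (Fin (n + 2) → Pt m)) where
  feasible := {w | 0 < w.1 ∧ (l ≤ w.1 ∧ w.1 ≤ u) ∧ D.NLPConstraints w.1 w.2.1 w.2.2}
  objective w := w.1 * ∑ k, w.2.1 k * D.objKernel (w.2.2 k)

/-- `P` is the law of a random vector whose restriction to `𝒟₀` is `c P'`, where `P'` is the law of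
`(s + U (Z₁ - s), Z₂, …, Z_d)` with `Z` of law `Q`. -/
def Recovers (c : ℝ) (Q P : Measure (Pt m)) : Prop :=
  IsProbabilityMeasure P ∧ P.restrict D.D₀ = ENNReal.ofReal c • mix D.s Q

end Data

end POU

end

open MeasureTheory ProbabilityTheory Set
open scoped NNReal ENNReal

noncomputable section

namespace POU

variable {m : ℕ}

/-! ### The mixing operation -/

/-! The 1-POU laws are identified with mixtures, in the manner of Khintchine's theorem on unimodal
laws. Each section of a 1-POU set in the first coordinate is, up to a null set, an interval starting
at `s`, so the uniform law on the set is `mix s Q` for an explicit `Q` (`exists_mix_eq_cond`).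
Mixtures with `Q` carried by the tail region form a convex, weakly closed set: `mix s` is weakly
continuous, and tightness of the mixtures forces tightness of the mixing laws (`isClosed_mixtures`).
Hence every 1-POU law is a mixture (`IsPOU.exists_mix`). Conversely, if `Q` gives no mass to `Z₁ =
s`, then `mix s Q` is a limit of convex combinations of uniform laws on thin boxes (`isPOU_mix`).

Conditionally on `Z` the first coordinate is uniform on `(s, Z₁)`, so probabilities of slabs become
expectations of length ratios (`mix_real_region`), and the marginal density at the mode is `c E[1 /
(Z₁ - s)]` (`lintegral_invKernel_le`, `exists_isMarginalDensity`). This turns the DRO problem into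
the moment problem.

For the reduction to atoms, the mean of an integrable vector lies in the convex hull of any set
carrying it, closed or not (`zero_mem_of_integral_eq_zero`). Carathéodory's theorem applied to the
`n + 1` constrained moments and the objective gives `n + 3` atoms, and one simplex step removes an
atom without lowering the objective (`exists_atoms_of_integral`). The claims on values and optimal
solutions then follow formally from domination between feasible sets. -/

lemma measurable_mixMap (s : ℝ) :
    Measurable (fun w : ℝ × Pt m => ((s + w.1 * (w.2.1 - s), w.2.2) : Pt m)) := by
  fun_prop

/-- Fubini with `U` integrated first: given `Z = z`, the mixture is uniform on the segment from `(s,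
z.2)` to `z`. -/
lemma mix_apply (s : ℝ) (Q : Measure (Pt m)) [SFinite Q] {A : Set (Pt m)} (hA : MeasurableSet A) :
    mix s Q A = ∫⁻ z, volume {u ∈ Ioo (0 : ℝ) 1 | ((s + u * (z.1 - s), z.2) : Pt m) ∈ A} ∂Q := by
  have hA' := measurable_mixMap (m := m) s hA
  rw [mix, Measure.map_apply (measurable_mixMap s) hA, Measure.prod_apply_symm hA']
  refine lintegral_congr fun z => ?_
  rw [Measure.restrict_apply (measurable_prodMk_right hA'), inter_comm]
  rfl

instance isProbabilityMeasure_unif : IsProbabilityMeasure (volume.restrict (Ioo (0 : ℝ) 1)) :=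
  ⟨by simp⟩

instance isProbabilityMeasure_mix (s : ℝ) (Q : Measure (Pt m)) [IsProbabilityMeasure Q] :
    IsProbabilityMeasure (mix s Q) :=
  Measure.isProbabilityMeasure_map (measurable_mixMap s).aemeasurable

lemma mix_add (s : ℝ) (Q R : Measure (Pt m)) [SFinite Q] [SFinite R] :
    mix s (Q + R) = mix s Q + mix s R := by
  ext A hA
  rw [Measure.add_apply, mix_apply s _ hA, mix_apply s _ hA, mix_apply s _ hA,
    lintegral_add_measure]

lemma mix_smul (s : ℝ) (c : ℝ≥0) (Q : Measure (Pt m)) [SFinite Q] :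
    mix s (c • Q) = c • mix s Q := by
  ext A hA
  rw [Measure.smul_apply, mix_apply s _ hA, mix_apply s _ hA, lintegral_smul_measure]

lemma mix_sum {ι : Type*} (s : ℝ) (t : Finset ι) (w : ι → ℝ≥0) (Q : ι → Measure (Pt m))
    [∀ i, IsFiniteMeasure (Q i)] :
    mix s (∑ i ∈ t, w i • Q i) = ∑ i ∈ t, w i • mix s (Q i) := by
  classical
  induction t using Finset.induction_on with
  | empty => simp [mix]
  | insert a t ha ih =>
    rw [Finset.sum_insert ha, Finset.sum_insert ha, mix_add, mix_smul, ih]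

lemma measurableSet_ge (y₀ : Fin m → EReal) :
    MeasurableSet {y : Fin m → ℝ | ∀ j, y₀ j ≤ (y j : EReal)} := by
  simp only [ofPred_forall]
  exact MeasurableSet.iInter fun j => measurableSet_le measurable_const
    (measurable_coe_real_ereal.comp (measurable_pi_apply j))

lemma isClosed_tail (s : ℝ) (y₀ : Fin m → EReal) : IsClosed (tail s y₀) := by
  have : tail s y₀ = {x | s ≤ x.1} ∩ ⋂ j, {x : Pt m | y₀ j ≤ (x.2 j : EReal)} := by
    ext x; simp [tail]
  rw [this]
  refine (isClosed_le continuous_const continuous_fst).inter (isClosed_iInter fun j => ?_)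
  exact isClosed_le continuous_const
    (continuous_coe_real_ereal.comp ((continuous_apply j).comp continuous_snd))

lemma measurableSet_tail (s : ℝ) (y₀ : Fin m → EReal) : MeasurableSet (tail s y₀) :=
  (isClosed_tail s y₀).measurableSet

lemma mix_tail (s : ℝ) (y₀ : Fin m → EReal) (Q : Measure (Pt m)) [IsProbabilityMeasure Q]
    (hQ : Q (tail s y₀) = 1) : mix s Q (tail s y₀) = 1 := by
  rw [mix_apply s _ (measurableSet_tail s y₀)]
  have hae : ∀ᵐ z ∂Q, z ∈ tail s y₀ := (prob_compl_eq_zero_iff (measurableSet_tail s y₀)).2 hQ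
  rw [lintegral_congr_ae (g := fun _ => 1)]
  · simp
  · filter_upwards [hae] with z hz
    have : {u ∈ Ioo (0 : ℝ) 1 | ((s + u * (z.1 - s), z.2) : Pt m) ∈ tail s y₀} = Ioo 0 1 := by
      ext u
      refine ⟨fun h => h.1, fun h => ⟨h, ?_, hz.2⟩⟩
      have := mul_nonneg h.1.le (sub_nonneg.2 hz.1)
      simpa using this
    rw [this]; simp

lemma mix_tail_compl (s : ℝ) (y₀ : Fin m → EReal) (Q : Measure (Pt m)) [IsProbabilityMeasure Q]
    (hQ : Q (tail s y₀) = 1) : mix s Q (tail s y₀)ᶜ = 0 :=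
  (prob_compl_eq_zero_iff (measurableSet_tail s y₀)).2 (mix_tail s y₀ Q hQ)

/-- The affine change of variables from `(0, 1)` to `(s, t)`. -/
lemma volume_affine_preimage {s t : ℝ} (hst : s < t) (B : Set ℝ) :
    volume {u ∈ Ioo (0 : ℝ) 1 | s + u * (t - s) ∈ B}
      = (ENNReal.ofReal (t - s))⁻¹ * volume (B ∩ Ioo s t) := by
  have h0 : 0 < t - s := sub_pos.2 hst
  have : {u ∈ Ioo (0 : ℝ) 1 | s + u * (t - s) ∈ B}
      = (fun u => u * (t - s)) ⁻¹' ((fun x => s + x) ⁻¹' (B ∩ Ioo s t)) := by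
    ext u
    simp only [mem_ofPred_eq, mem_Ioo, mem_preimage, mem_inter_iff]
    have e1 : 0 < u ↔ s < s + u * (t - s) := by
      constructor
      · intro h; have := mul_pos h h0; linarith
      · intro h; exact pos_of_mul_pos_left (by linarith) h0.le
    have e2 : u < 1 ↔ s + u * (t - s) < t := by
      constructor <;> intro h <;> nlinarith
    rw [e1, e2]; tauto
  rw [this, Real.volume_preimage_mul_right h0.ne', measure_preimage_add,
    abs_of_pos (inv_pos.2 h0), ENNReal.ofReal_inv_of_pos h0]

/-! ### Probabilities of slabs under a mixture -/

lemma cap_le {e : EReal} {s t : ℝ} (hst : s < t) (hse : (s : EReal) ≤ e) :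
    cap e t ∈ Icc s t ∧ (∀ x < t, e ≤ (x : EReal) ↔ cap e t ≤ x) ∧
      (∀ x < t, (x : EReal) ≤ e ↔ x ≤ cap e t) := by
  induction e with
  | bot => simp at hse
  | top =>
    have : cap ⊤ t = t := by simp [cap]
    rw [this]
    refine ⟨⟨hst.le, le_rfl⟩, fun x hx => ?_, fun x hx => ?_⟩
    · simp [hx]
    · simp [hx.le]
  | coe r =>
    have : cap r t = min r t := by
      rw [cap, ← EReal.coe_strictMono.monotone.map_min, EReal.toReal_coe]
    rw [this]
    rw [EReal.coe_le_coe_iff] at hse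
    refine ⟨⟨le_min hse hst.le, min_le_right _ _⟩, fun x hx => ?_, fun x hx => ?_⟩
    · simp [hx]
    · simp [hx.le]

lemma cap_mono {e₁ e₂ : EReal} {s t : ℝ} (hst : s < t) (hs : (s : EReal) ≤ e₁) (h : e₁ ≤ e₂) :
    cap e₁ t ≤ cap e₂ t := by
  refine EReal.toReal_le_toReal (min_le_min_right _ h) ?_ ?_
  · exact (lt_of_lt_of_le (EReal.bot_lt_coe s)
      (le_min hs (EReal.coe_le_coe_iff.2 hst.le))).ne'
  · exact (lt_of_le_of_lt (min_le_right _ _) (EReal.coe_lt_top t)).ne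

lemma cap_coe (r t : ℝ) : cap r t = min t r := by
  rw [cap, ← EReal.coe_strictMono.monotone.map_min, EReal.toReal_coe, min_comm]

/-- Inside `(s, t)` the extended thresholds can be replaced by their real truncations at `t`; the
interval between these lies in `[s, t]`, and its relative length is the kernel of the moment
problem. -/
lemma volume_affine_interval {s t : ℝ} (hst : s < t) {e₁ e₂ : EReal} (hs : (s : EReal) ≤ e₁)
    (h : e₁ ≤ e₂) :
    volume {u ∈ Ioo (0 : ℝ) 1 | s + u * (t - s) ∈ {x : ℝ | e₁ ≤ (x : EReal) ∧ (x : EReal) ≤ e₂}}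
      = ENNReal.ofReal ((cap e₂ t - cap e₁ t) / (t - s)) := by
  obtain ⟨h1, h1', -⟩ := cap_le hst hs
  obtain ⟨h2, -, h2'⟩ := cap_le hst (hs.trans h)
  rw [volume_affine_preimage hst]
  have : {x : ℝ | e₁ ≤ (x : EReal) ∧ (x : EReal) ≤ e₂} ∩ Ioo s t
      = Icc (cap e₁ t) (cap e₂ t) ∩ Ioo s t := by
    ext x
    simp only [mem_inter_iff, mem_ofPred_eq, mem_Icc]
    refine and_congr_left fun hx => ?_
    rw [h1' x hx.2, h2' x hx.2]
  have hsub : Icc (cap e₁ t) (cap e₂ t) ⊆ Icc s t := Icc_subset_Icc h1.1 h2.2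
  rw [this, measure_congr ((ae_eq_refl (Icc (cap e₁ t) (cap e₂ t))).inter Ioo_ae_eq_Icc),
    inter_eq_self_of_subset_left hsub, Real.volume_Icc, ENNReal.ofReal_div_of_pos (sub_pos.2 hst),
    div_eq_mul_inv, mul_comm]

lemma cap_ratio_mem {s t : ℝ} (hst : s < t) {e₁ e₂ : EReal} (hs : (s : EReal) ≤ e₁)
    (h : e₁ ≤ e₂) : (cap e₂ t - cap e₁ t) / (t - s) ∈ Icc (0 : ℝ) 1 := by
  have h1 := (cap_le hst hs).1
  have h2 := (cap_le hst (hs.trans h)).1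
  have h3 := cap_mono hst hs h
  have h0 := sub_pos.2 hst
  refine ⟨div_nonneg (sub_nonneg.2 h3) h0.le, (div_le_one h0).2 ?_⟩
  have := h1.1; have := h2.2
  linarith

lemma measurable_cap {e : (Fin m → ℝ) → EReal} (he : Measurable e) :
    Measurable fun z : Pt m => cap (e z.2) z.1 := by
  unfold cap
  exact ((he.comp measurable_snd).min
    (measurable_coe_real_ereal.comp measurable_fst)).ereal_toReal

lemma measurableSet_region {e₁ e₂ : (Fin m → ℝ) → EReal} (h₁ : Measurable e₁)
    (h₂ : Measurable e₂) {T : Set (Fin m → ℝ)} (hT : MeasurableSet T) :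
    MeasurableSet {x : Pt m | (e₁ x.2 ≤ (x.1 : EReal) ∧ (x.1 : EReal) ≤ e₂ x.2) ∧ x.2 ∈ T} := by
  have hc : Measurable fun x : Pt m => (x.1 : EReal) :=
    measurable_coe_real_ereal.comp measurable_fst
  exact ((measurableSet_le (h₁.comp measurable_snd) hc).inter
    (measurableSet_le hc (h₂.comp measurable_snd))).inter (measurable_snd hT)

/-- Common source of the objective, where the thresholds vary with the other coordinates, and of the
box constraints, where they are constant. -/
lemma mix_real_region (s : ℝ) (Q : Measure (Pt m)) [IsProbabilityMeasure Q]
    (hQ : ∀ᵐ z ∂Q, s < z.1) {e₁ e₂ : (Fin m → ℝ) → EReal} (h₁ : Measurable e₁)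
    (h₂ : Measurable e₂) {T : Set (Fin m → ℝ)} (hT : MeasurableSet T)
    (hs : ∀ y ∈ T, (s : EReal) ≤ e₁ y) (hle : ∀ y ∈ T, e₁ y ≤ e₂ y) :
    (mix s Q).real {x | (e₁ x.2 ≤ (x.1 : EReal) ∧ (x.1 : EReal) ≤ e₂ x.2) ∧ x.2 ∈ T}
      = ∫ z, (cap (e₂ z.2) z.1 - cap (e₁ z.2) z.1) / (z.1 - s) * T.indicator 1 z.2 ∂Q := by
  classical
  have hm := measurableSet_region h₁ h₂ hT
  rw [integral_eq_lintegral_of_nonneg_ae, Measure.real, mix_apply s _ hm]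
  · congr 1
    refine lintegral_congr_ae ?_
    filter_upwards [hQ] with z hz
    by_cases hzT : z.2 ∈ T
    · simp only [hzT, and_true, indicator_of_mem, Pi.one_apply, mul_one]
      exact volume_affine_interval hz (hs _ hzT) (hle _ hzT)
    · simp [hzT]
  · filter_upwards [hQ] with z hz
    by_cases hzT : z.2 ∈ T
    · simpa [hzT] using (cap_ratio_mem hz (hs _ hzT) (hle _ hzT)).1
    · simp [hzT]
  · exact ((((measurable_cap h₂).sub (measurable_cap h₁)).div
      (measurable_fst.sub_const s)).mul
      ((measurable_one.indicator hT).comp measurable_snd)).aestronglyMeasurable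

/-! ### The marginal density at the mode -/

namespace Data

variable {n : ℕ} (D : Data m n)

lemma measurable_invKernel : Measurable D.invKernel :=
  (ENNReal.measurable_ofReal.comp (measurable_fst.sub_const D.s)).inv

/-- The left side is `min(1, h / (z₁ - s))`, the probability that `U (z₁ - s) < h`. With `1 / 0 = ∞`
it equals `1` at the mode, as it should. -/
lemma mul_min_invKernel_le {h : ℝ} (hh : 0 < h) {z : Pt m} (hz : D.s ≤ z.1) :
    ENNReal.ofReal h * min (ENNReal.ofReal h)⁻¹ (D.invKernel z)
      ≤ volume {u ∈ Ioo (0 : ℝ) 1 | D.s + u * (z.1 - D.s) ∈ Ico D.s (D.s + h)} := by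
  have hh' : ENNReal.ofReal h ≠ 0 := by simpa using hh
  rcases hz.eq_or_lt with hz | hz
  · have : {u ∈ Ioo (0 : ℝ) 1 | D.s + u * (z.1 - D.s) ∈ Ico D.s (D.s + h)} = Ioo 0 1 := by
      ext u; simp [← hz, hh]
    rw [this]
    calc _ ≤ ENNReal.ofReal h * (ENNReal.ofReal h)⁻¹ := by gcongr; exact min_le_left _ _
      _ = 1 := ENNReal.mul_inv_cancel hh' ENNReal.ofReal_ne_top
      _ = _ := by simp
  · have h0 : 0 < z.1 - D.s := sub_pos.2 hz
    rw [volume_affine_preimage hz]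
    have hsub : Ioo D.s (min (D.s + h) z.1) ⊆ Ico D.s (D.s + h) ∩ Ioo D.s z.1 := by
      intro x hx
      obtain ⟨h1, h2⟩ := hx
      rw [lt_min_iff] at h2
      exact ⟨⟨h1.le, h2.1⟩, h1, h2.2⟩
    refine le_trans ?_ (mul_le_mul_right (measure_mono hsub) _)
    rw [Real.volume_Ioo]
    rcases le_total (D.s + h) z.1 with hle | hle
    · rw [min_eq_left hle, add_sub_cancel_left, mul_comm]
      gcongr
      exact min_le_right _ _
    · rw [min_eq_right hle, ENNReal.inv_mul_cancel (by simpa using h0) ENNReal.ofReal_ne_top]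
      calc _ ≤ ENNReal.ofReal h * (ENNReal.ofReal h)⁻¹ := by gcongr; exact min_le_left _ _
        _ = 1 := ENNReal.mul_inv_cancel hh' ENNReal.ofReal_ne_top

/-- The mass of the strip `[s, s + h)` is at least `c h E[min(1/h, 1/(Z₁ - s))]`, and by continuity
of `f` at `s` it is at most `h (f(s) + ε)` for small `h`. Dividing by `h` and letting `h → 0` gives
the bound. Mass of `Q` at the mode is not excluded beforehand; its absence follows from the bound.
-/
lemma lintegral_invKernel_le {c : ℝ} (hc : 0 < c) {Q P : Measure (Pt m)} [IsProbabilityMeasure Q]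
    (hQ : ∀ᵐ z ∂Q, D.s ≤ z.1) (hP : P.restrict D.D₀ = ENNReal.ofReal c • mix D.s Q)
    {f : ℝ → ℝ≥0∞} (hf : D.IsMarginalDensity P f) (hfs : f D.s ≤ ENNReal.ofReal D.uX) :
    ∫⁻ z, D.invKernel z ∂Q ≤ ENNReal.ofReal (D.uX / c) := by
  have hc' : ENNReal.ofReal c ≠ 0 := by simpa using hc
  rw [ENNReal.ofReal_div_of_pos hc, ENNReal.le_div_iff_mul_le (Or.inl hc')
    (Or.inl ENNReal.ofReal_ne_top), mul_comm]
  refine le_trans ?_ hfs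
  refine ENNReal.le_of_forall_pos_le_add fun ε hε hfin => ?_
  have hev : ∀ᶠ t in nhdsWithin D.s (Ici D.s), f t < f D.s + ε :=
    hf.2.1.eventually_lt_const (ENNReal.lt_add_right hfin.ne (by simpa using hε.ne'))
  obtain ⟨b, hb, hbf⟩ := (mem_nhdsGE_iff_exists_Ico_subset).1 hev
  have hb : D.s < b := hb
  -- Along `h = 1 / (k + 1)` the truncation level is `k + 1`, so monotone convergence applies.
  have hlim : Filter.Tendsto
      (fun k : ℕ => ENNReal.ofReal c * ∫⁻ z, min (ENNReal.ofReal (1 / ((k : ℝ) + 1)))⁻¹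
        (D.invKernel z) ∂Q) Filter.atTop
      (nhds (ENNReal.ofReal c * ∫⁻ z, D.invKernel z ∂Q)) := by
    refine ENNReal.Tendsto.const_mul ?_ (Or.inr ENNReal.ofReal_ne_top)
    have hinv : ∀ k : ℕ, (ENNReal.ofReal (1 / ((k : ℝ) + 1)))⁻¹ = (k : ℝ≥0∞) + 1 := by
      intro k
      rw [← ENNReal.ofReal_inv_of_pos (by positivity), one_div, inv_inv,
        ENNReal.ofReal_add (by positivity) zero_le_one, ENNReal.ofReal_natCast, ENNReal.ofReal_one]
    simp_rw [hinv]
    refine lintegral_tendsto_of_tendsto_of_monotone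
      (fun k => (measurable_const.min D.measurable_invKernel).aemeasurable)
      (Filter.Eventually.of_forall fun z i j hij => ?_) (Filter.Eventually.of_forall fun z => ?_)
    · have : (i : ℝ≥0∞) ≤ j := by exact_mod_cast hij
      dsimp only
      gcongr
    · have h1 : Filter.Tendsto (fun k : ℕ => (k : ℝ≥0∞) + 1) Filter.atTop (nhds ⊤) := by
        have := (Filter.tendsto_add_atTop_iff_nat 1).2 ENNReal.tendsto_nat_nhds_top
        simpa using this
      simpa using h1.min (tendsto_const_nhds (x := D.invKernel z))
  refine le_of_tendsto hlim ?_
  have hsmall : ∀ᶠ k : ℕ in Filter.atTop, 1 / ((k : ℝ) + 1) < b - D.s :=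
    tendsto_one_div_add_atTop_nhds_zero_nat.eventually_lt_const (sub_pos.2 hb)
  filter_upwards [hsmall] with k hk
  set h : ℝ := 1 / ((k : ℝ) + 1) with hh
  have hpos : 0 < h := by positivity
  have hh0 : ENNReal.ofReal h ≠ 0 := by simpa using hpos
  have hmeas : MeasurableSet {x : Pt m | x.1 ∈ Ico D.s (D.s + h)} := measurable_fst measurableSet_Ico
  have h1 : ENNReal.ofReal c * (ENNReal.ofReal h * ∫⁻ z, min (ENNReal.ofReal h)⁻¹
      (D.invKernel z) ∂Q) ≤ P.restrict D.D₀ {x | x.1 ∈ Ico D.s (D.s + h)} := by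
    rw [hP, Measure.smul_apply, smul_eq_mul, mix_apply _ _ hmeas, ← lintegral_const_mul _
      (measurable_const.min D.measurable_invKernel)]
    refine mul_le_mul_right (lintegral_mono_ae ?_) _
    filter_upwards [hQ] with z hz using D.mul_min_invKernel_le hpos hz
  have h2 : P.restrict D.D₀ {x | x.1 ∈ Ico D.s (D.s + h)} ≤ ENNReal.ofReal h * (f D.s + ε) := by
    rw [Measure.restrict_apply hmeas]
    have := hf.2.2 (Ico D.s (D.s + h)) measurableSet_Ico Ico_subset_Ici_self
    have heq : {x : Pt m | x.1 ∈ Ico D.s (D.s + h)} ∩ D.D₀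
        = {x | x ∈ D.D₀ ∧ x.1 ∈ Ico D.s (D.s + h)} := by
      ext x; exact and_comm
    rw [heq, ← this]
    calc _ ≤ ∫⁻ _ in Ico D.s (D.s + h), (f D.s + ε) := by
          refine setLIntegral_mono measurable_const fun t ht => ?_
          exact (hbf ⟨ht.1, by linarith [ht.2]⟩ : f t < _).le
      _ = _ := by simp [mul_comm]
  have h3 := h1.trans h2
  rw [mul_left_comm] at h3
  exact (ENNReal.mul_le_mul_iff_right hh0 ENNReal.ofReal_ne_top).1 h3

lemma exists_isMarginalDensity {c : ℝ} (hc : 0 < c) {Q P : Measure (Pt m)}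
    [IsProbabilityMeasure Q] (hQ : ∀ᵐ z ∂Q, D.s < z.1)
    (hP : P.restrict D.D₀ = ENNReal.ofReal c • mix D.s Q)
    (hinv : ∫⁻ z, D.invKernel z ∂Q ≤ ENNReal.ofReal (D.uX / c)) :
    ∃ f, D.IsMarginalDensity P f ∧ f D.s ≤ ENNReal.ofReal D.uX := by
  have hc' : ENNReal.ofReal c ≠ 0 := by simpa using hc
  have hfin : ∫⁻ z, D.invKernel z ∂Q ≠ ⊤ := (hinv.trans_lt ENNReal.ofReal_lt_top).ne
  -- For `t ≥ s` this is the density at `t` of the uniform law on `(s, z₁)`. It is constant in `t`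
  -- near `s` and dominated by `1 / (z₁ - s)`, which yields continuity at `s` of its average over
  -- `Q`.
  set G : ℝ → Pt m → ℝ≥0∞ := fun t z => (Iio z.1).indicator (fun _ => D.invKernel z) t with hG
  have hGle : ∀ t z, G t z ≤ D.invKernel z := fun t z => indicator_le_self' (by simp) t
  have hGm : Measurable fun w : ℝ × Pt m => G w.1 w.2 := by
    have : (fun w : ℝ × Pt m => G w.1 w.2)
        = {w : ℝ × Pt m | w.1 < w.2.1}.indicator fun w => D.invKernel w.2 := by
      ext w; simp [hG, indicator]
    rw [this]
    exact (D.measurable_invKernel.comp measurable_snd).indicator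
      (measurableSet_lt measurable_fst (measurable_fst.comp measurable_snd))
  refine ⟨fun t => ENNReal.ofReal c * ∫⁻ z, G t z ∂Q, ⟨?_, ?_, ?_⟩, ?_⟩
  · exact (hGm.lintegral_prod_right').const_mul _
  · refine ENNReal.Tendsto.const_mul ?_ (Or.inr ENNReal.ofReal_ne_top)
    refine tendsto_lintegral_filter_of_dominated_convergence D.invKernel
      (Filter.Eventually.of_forall fun t => hGm.comp measurable_prodMk_left)
      (Filter.Eventually.of_forall fun t => Filter.Eventually.of_forall fun z => hGle t z) hfin ?_
    filter_upwards [hQ] with z hz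
    refine tendsto_nhdsWithin_of_tendsto_nhds ?_
    refine tendsto_const_nhds.congr' ?_
    filter_upwards [Iio_mem_nhds hz] with t ht
    have ht : t < z.1 := ht
    simp [hG, hz, ht]
  · intro A hA hAs
    have hmeas : MeasurableSet {x : Pt m | x.1 ∈ A} := measurable_fst hA
    have heq : {x : Pt m | x ∈ D.D₀ ∧ x.1 ∈ A} = {x : Pt m | x.1 ∈ A} ∩ D.D₀ := by
      ext x; exact and_comm
    rw [heq, ← Measure.restrict_apply hmeas, hP, Measure.smul_apply, smul_eq_mul,
      mix_apply _ _ hmeas, lintegral_const_mul _ hGm.lintegral_prod_right',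
      lintegral_lintegral_swap hGm.aemeasurable]
    congr 1
    refine lintegral_congr_ae ?_
    filter_upwards [hQ] with z hz
    rw [volume_affine_preimage hz, lintegral_indicator measurableSet_Iio, setLIntegral_const,
      Measure.restrict_apply measurableSet_Iio, inter_comm (Iio z.1)]
    change D.invKernel z * _ = D.invKernel z * _
    congr 1
    have h1 : A ∩ Iio z.1 = A ∩ Ico D.s z.1 := by
      ext t
      exact ⟨fun h => ⟨h.1, hAs h.1, h.2⟩, fun h => ⟨h.1, h.2.2⟩⟩
    rw [h1]
    exact measure_congr ((ae_eq_refl A).inter Ioo_ae_eq_Ico.symm)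
  · calc _ ≤ ENNReal.ofReal c * ENNReal.ofReal (D.uX / c) := by
          exact mul_le_mul_right ((lintegral_mono fun z => hGle _ z).trans hinv) _
      _ = ENNReal.ofReal D.uX := by
          rw [← ENNReal.ofReal_mul hc.le, mul_div_cancel₀ _ hc.ne']

lemma ae_lt_of_lintegral_invKernel {Q : Measure (Pt m)} [IsProbabilityMeasure Q]
    (hinv : ∫⁻ z, D.invKernel z ∂Q ≠ ⊤) : ∀ᵐ z ∂Q, D.s < z.1 := by
  filter_upwards [ae_lt_top D.measurable_invKernel hinv] with z hz
  simpa [invKernel] using hz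

end Data

/-! ### Uniform distributions on 1-POU sets are mixtures -/

lemma measurable_volume_mixMap_section (s : ℝ) {A : Set (Pt m)} (hA : MeasurableSet A) :
    Measurable fun z : Pt m =>
      volume {u ∈ Ioo (0 : ℝ) 1 | ((s + u * (z.1 - s), z.2) : Pt m) ∈ A} := by
  have hA' := measurable_mixMap (m := m) s hA
  have := measurable_measure_prodMk_right (μ := volume.restrict (Ioo (0 : ℝ) 1)) hA'
  convert this using 2 with z
  rw [Measure.restrict_apply (measurable_prodMk_right hA'), inter_comm]
  rfl

/-- A point `t ≥ s` missing from `B` forces `B ⊆ [s, t]`, and a point `x` of `B` forces `[s, x] ⊆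
B`; comparing lengths leaves only the endpoints undetermined. -/
lemma section_ae_eq {s : ℝ} {B : Set ℝ} (hBs : B ⊆ Ici s)
    (hB : ∀ x ∈ B, ∀ t, s ≤ t → t ≤ x → t ∈ B) (hfin : volume B ≠ ∞) :
    B =ᵐ[volume] Ioo s (s + (volume B).toReal) := by
  have h1 : Ioo s (s + (volume B).toReal) ⊆ B := by
    intro t ht
    by_contra htB
    have : B ⊆ Icc s t := fun x hx => ⟨hBs hx, by
      by_contra! hlt
      exact htB (hB x hx t ht.1.le hlt.le)⟩
    have h2 := ENNReal.toReal_mono (by simp) (measure_mono (μ := volume) this)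
    rw [Real.volume_Icc, ENNReal.toReal_ofReal (by linarith [ht.1])] at h2
    linarith [ht.2]
  have h2 : B ⊆ Icc s (s + (volume B).toReal) := by
    intro x hx
    refine ⟨hBs hx, ?_⟩
    have : Icc s x ⊆ B := fun t ht => hB x hx t ht.1 ht.2
    have h2 := ENNReal.toReal_mono hfin (measure_mono (μ := volume) this)
    rw [Real.volume_Icc, ENNReal.toReal_ofReal (by linarith [show s ≤ x from hBs hx])] at h2
    linarith
  refine Filter.EventuallyLE.antisymm ?_ h1.eventuallyLE
  exact h2.eventuallyLE.trans Ioo_ae_eq_Icc.symm.le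

/-- `Z` is the upper end of the section over `Y`, where `Y` has density proportional to the section
length. This weight cancels the factor `1 / length` of the uniform law on the section. The almost
sure clause serves to locate `Z`. -/
lemma exists_mix_eq_cond {s : ℝ} {y₀ : Fin m → EReal} {K : Set (Pt m)} (hK : IsPOUSet s y₀ K)
    (h0 : volume K ≠ 0) (hfin : volume K ≠ ∞) :
    ∃ Q : Measure (Pt m), IsProbabilityMeasure Q ∧
      (∀ᵐ z ∂Q, volume {t : ℝ | (t, z.2) ∈ K} ≠ 0 ∧
        z.1 = s + (volume {t : ℝ | (t, z.2) ∈ K}).toReal) ∧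
      mix s Q = ProbabilityTheory.cond volume K := by
  set len : (Fin m → ℝ) → ℝ≥0∞ := fun y => volume {t : ℝ | (t, y) ∈ K} with hlen
  have hlm : Measurable len := measurable_measure_prodMk_right (μ := (volume : Measure ℝ)) hK.1
  have hlint : ∫⁻ y, len y = volume K := by
    rw [Measure.volume_eq_prod, Measure.prod_apply_symm hK.1]; rfl
  have hlfin : ∀ᵐ y, len y < ∞ := ae_lt_top hlm (by rwa [hlint])
  have hφ : Measurable fun y : Fin m → ℝ => ((s + (len y).toReal, y) : Pt m) := by fun_prop
  set R : Measure (Fin m → ℝ) := (volume K)⁻¹ • (volume : Measure (Fin m → ℝ)).withDensity len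
    with hR
  have hRp : IsProbabilityMeasure R := ⟨by
    rw [hR, Measure.smul_apply, withDensity_apply _ MeasurableSet.univ, Measure.restrict_univ,
      hlint, smul_eq_mul, ENNReal.inv_mul_cancel h0 hfin]⟩
  have hQp := Measure.isProbabilityMeasure_map (μ := R) hφ.aemeasurable
  refine ⟨R.map fun y => (s + (len y).toReal, y), hQp, ?_, ?_⟩
  · refine (ae_map_iff hφ.aemeasurable ?_).2 ?_
    · refine MeasurableSet.inter ?_ ?_
      · exact (hlm.comp measurable_snd) (measurableSet_singleton 0).compl
      · exact measurableSet_eq_fun measurable_fst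
          (measurable_const.add (hlm.comp measurable_snd).ennreal_toReal)
    · refine Measure.ae_smul_measure ?_ _
      rw [ae_withDensity_iff hlm]
      exact Filter.Eventually.of_forall fun y hy => ⟨hy, rfl⟩
  · ext A hA
    rw [mix_apply _ _ hA, lintegral_map (measurable_volume_mixMap_section s hA) hφ, hR,
      lintegral_smul_measure]
    have key := lintegral_withDensity_eq_lintegral_mul volume hlm
      ((measurable_volume_mixMap_section s hA).comp hφ)
    simp only [Function.comp_def] at key
    rw [key, cond_apply hK.1, smul_eq_mul,
      Measure.volume_eq_prod, Measure.prod_apply_symm (hK.1.inter hA)]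
    congr 1
    refine lintegral_congr_ae ?_
    filter_upwards [hlfin] with y hy
    simp only [Pi.mul_apply]
    have hpre : (fun x : ℝ => (x, y)) ⁻¹' (K ∩ A) = {t | (t, y) ∈ K} ∩ {t | (t, y) ∈ A} := rfl
    have hsub : {t : ℝ | (t, y) ∈ K} ⊆ Ici s := fun t ht => (hK.2.1 ht).1
    have hae := section_ae_eq hsub (fun x hx t h1 h2 => hK.2.2 (x, y) hx t h1 h2) hy.ne
    rw [hpre, measure_congr (hae.inter (ae_eq_refl {t | (t, y) ∈ A}))]
    change len y * volume {u ∈ Ioo (0 : ℝ) 1 | s + u * (s + (len y).toReal - s) ∈ {t | (t, y) ∈ A}}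
      = volume (Ioo s (s + (len y).toReal) ∩ {t | (t, y) ∈ A})
    by_cases hz : len y = 0
    · simp [hz]
    · have hpos : 0 < (len y).toReal := ENNReal.toReal_pos hz hy.ne
      rw [volume_affine_preimage (by linarith), add_sub_cancel_left, ENNReal.ofReal_toReal hy.ne,
        ← mul_assoc, ENNReal.mul_inv_cancel hz hy.ne, one_mul, inter_comm]

lemma convex_mixtures (s : ℝ) (y₀ : Fin m → EReal) :
    Convex ℝ≥0 {ν : Measure (Pt m) | ∃ Q : Measure (Pt m), IsProbabilityMeasure Q ∧
      Q (tail s y₀) = 1 ∧ mix s Q = ν} := by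
  rintro _ ⟨Q, hQ, hQt, rfl⟩ _ ⟨R, hR, hRt, rfl⟩ a b - - hab
  have hab' : (a : ℝ≥0∞) + b = 1 := by exact_mod_cast hab
  refine ⟨a • Q + b • R, ⟨?_⟩, ?_, ?_⟩
  · rw [Measure.add_apply, Measure.coe_nnreal_smul_apply, Measure.coe_nnreal_smul_apply,
      measure_univ, measure_univ, mul_one, mul_one, hab']
  · rw [Measure.add_apply, Measure.coe_nnreal_smul_apply, Measure.coe_nnreal_smul_apply,
      hQt, hRt, mul_one, mul_one, hab']
  · rw [mix_add, mix_smul, mix_smul]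

lemma convexHull_uniformPOU_subset (s : ℝ) (y₀ : Fin m → EReal) :
    convexHull ℝ≥0 (uniformPOU s y₀) ⊆ {ν : Measure (Pt m) | ∃ Q : Measure (Pt m),
      IsProbabilityMeasure Q ∧ Q (tail s y₀) = 1 ∧ mix s Q = ν} := by
  refine convexHull_min ?_ (convex_mixtures s y₀)
  rintro _ ⟨K, hK, h0, hfin, rfl⟩
  obtain ⟨Q, hQ, hQae, hmix⟩ := exists_mix_eq_cond hK h0 hfin
  refine ⟨Q, hQ, ?_, hmix⟩
  rw [← prob_compl_eq_zero_iff (measurableSet_tail s y₀)]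
  change ∀ᵐ z ∂Q, z ∈ tail s y₀
  filter_upwards [hQae] with z hz
  obtain ⟨t, ht⟩ := nonempty_of_measure_ne_zero hz.1
  refine ⟨?_, (hK.2.1 ht).2⟩
  rw [hz.2]
  linarith [ENNReal.toReal_nonneg (a := volume {t : ℝ | (t, z.2) ∈ K})]

/-! ### Weak limits of mixtures -/

/-- `mix s` as a map on probability measures. -/
def mixProb (s : ℝ) (Q : ProbabilityMeasure (Pt m)) : ProbabilityMeasure (Pt m) :=
  ⟨mix s Q, inferInstance⟩

/-- Mixing is the product with a fixed law followed by a continuous pushforward. -/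
lemma continuous_mixProb (s : ℝ) : Continuous (mixProb (m := m) s) := by
  let ν : ProbabilityMeasure ℝ := ⟨volume.restrict (Ioo (0 : ℝ) 1), inferInstance⟩
  have hc : Continuous fun w : ℝ × Pt m => ((s + w.1 * (w.2.1 - s), w.2.2) : Pt m) := by
    fun_prop
  have h1 : Continuous fun Q : ProbabilityMeasure (Pt m) => ν.prod Q :=
    ProbabilityMeasure.continuous_prod.comp (continuous_const.prodMk continuous_id)
  exact (ProbabilityMeasure.continuous_map hc).comp h1

/-- With probability `1/2` one has `U > 1/2`, and then a point outside the ball of radius `2R` about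
`(s, 0)` is moved to a point outside the ball of radius `R`: only the first coordinate shrinks, by
less than half. -/
lemma measure_compl_closedBall_le (s : ℝ) (Q : Measure (Pt m)) [IsProbabilityMeasure Q] {R : ℝ}
    (hR : 0 ≤ R) :
    Q (Metric.closedBall ((s, 0) : Pt m) (2 * R))ᶜ
      ≤ 2 * mix s Q (Metric.closedBall ((s, 0) : Pt m) R)ᶜ := by
  have hm : MeasurableSet (Metric.closedBall ((s, 0) : Pt m) R)ᶜ :=
    Metric.isClosed_closedBall.measurableSet.compl
  have hm2 : MeasurableSet (Metric.closedBall ((s, 0) : Pt m) (2 * R))ᶜ :=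
    Metric.isClosed_closedBall.measurableSet.compl
  rw [mix_apply s _ hm, ← lintegral_indicator_one hm2,
    ← lintegral_const_mul _ (measurable_volume_mixMap_section s hm)]
  refine lintegral_mono fun z => ?_
  by_cases hz : z ∈ (Metric.closedBall ((s, 0) : Pt m) (2 * R))ᶜ
  · rw [indicator_of_mem hz, Pi.one_apply]
    have hsub : Ioo (1 / 2 : ℝ) 1 ⊆ {u ∈ Ioo (0 : ℝ) 1 |
        ((s + u * (z.1 - s), z.2) : Pt m) ∈ (Metric.closedBall ((s, 0) : Pt m) R)ᶜ} := by
      intro u hu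
      refine ⟨⟨by linarith [hu.1], hu.2⟩, ?_⟩
      simp only [mem_compl_iff, Metric.mem_closedBall, Prod.dist_eq, not_le, lt_max_iff] at hz ⊢
      rcases hz with hz | hz
      · left
        rw [Real.dist_eq] at hz ⊢
        rw [add_sub_cancel_left, abs_mul, abs_of_pos (by linarith [hu.1])]
        nlinarith [hu.1]
      · right; linarith
    calc (1 : ℝ≥0∞) = 2 * volume (Ioo (1 / 2 : ℝ) 1) := by
          rw [Real.volume_Ioo, show (1 : ℝ) - 1 / 2 = 2⁻¹ by norm_num,
            ENNReal.ofReal_inv_of_pos two_pos, ENNReal.ofReal_ofNat,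
            ENNReal.mul_inv_cancel two_ne_zero ENNReal.ofNat_ne_top]
      _ ≤ _ := mul_le_mul_right (measure_mono hsub) _
  · rw [indicator_of_notMem hz]; exact zero_le

/-- A convergent sequence of mixtures is tight, hence so are the mixing laws by the ball estimate.
Prokhorov's theorem gives a limit point, which is carried by the closed tail region (portmanteau)
and is mapped to the given limit by continuity of mixing. -/
lemma isClosed_mixtures (s : ℝ) (y₀ : Fin m → EReal) :
    IsClosed (mixProb s '' {Q : ProbabilityMeasure (Pt m) |
      (Q : Measure (Pt m)) (tail s y₀) = 1}) := by
  refine isClosed_of_closure_subset fun η hη => ?_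
  obtain ⟨η', hη', hlim⟩ := mem_closure_iff_seq_limit.1 hη
  choose Q hQ hQη using hη'
  have htight : IsTightMeasureSet
      {((μ : ProbabilityMeasure (Pt m)) : Measure (Pt m)) | μ ∈ range η'} := by
    refine isTightMeasureSet_of_isCompact_closure
      (hlim.isCompact_insert_range.closure_of_subset (subset_insert _ _))
  have htightQ : IsTightMeasureSet
      {((μ : ProbabilityMeasure (Pt m)) : Measure (Pt m)) | μ ∈ range Q} := by
    rw [isTightMeasureSet_iff_exists_isCompact_measure_compl_le] at htight ⊢
    intro ε hε
    obtain ⟨K, hK, hKε⟩ := htight (ε / 2) (ENNReal.half_pos hε.ne')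
    obtain ⟨R, hR0, hR⟩ := hK.isBounded.subset_closedBall_lt 0 ((s, 0) : Pt m)
    refine ⟨Metric.closedBall (s, 0) (2 * R), isCompact_closedBall _ _, ?_⟩
    rintro _ ⟨_, ⟨k, rfl⟩, rfl⟩
    refine (measure_compl_closedBall_le s _ hR0.le).trans ?_
    have h1 : mix s (Q k : Measure (Pt m)) = η' k := congrArg Subtype.val (hQη k)
    rw [h1]
    calc _ ≤ 2 * (η' k : Measure (Pt m)) Kᶜ :=
          mul_le_mul_right (measure_mono (compl_subset_compl.2 hR)) _
      _ ≤ 2 * (ε / 2) := mul_le_mul_right (hKε _ ⟨η' k, ⟨k, rfl⟩, rfl⟩) _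
      _ = ε := ENNReal.mul_div_cancel two_ne_zero ENNReal.ofNat_ne_top
  obtain ⟨Q', -, φ, hφ, hQ'⟩ := (isCompact_closure_of_isTightMeasureSet htightQ).isSeqCompact
    (fun k => subset_closure (mem_range_self k))
  refine ⟨Q', ?_, ?_⟩
  · have h1 := ProbabilityMeasure.limsup_measure_closed_le_of_tendsto hQ' (isClosed_tail s y₀)
    have h2 : ∀ k, ((Q ∘ φ) k : Measure (Pt m)) (tail s y₀) = 1 := fun k => hQ (φ k)
    simp only [h2, Filter.limsup_const] at h1
    exact le_antisymm prob_le_one h1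
  · refine tendsto_nhds_unique (((continuous_mixProb s).tendsto Q').comp hQ') ?_
    have := hlim.comp hφ.tendsto_atTop
    refine this.congr fun k => ?_
    simp [hQη]

lemma IsPOU.exists_mix {s : ℝ} {y₀ : Fin m → EReal} {ν : Measure (Pt m)} (h : IsPOU s y₀ ν) :
    ∃ Q : Measure (Pt m), IsProbabilityMeasure Q ∧ Q (tail s y₀) = 1 ∧ mix s Q = ν := by
  obtain ⟨ν', rfl, hν'⟩ := h
  have hsub : {η : ProbabilityMeasure (Pt m) |
      (η : Measure (Pt m)) ∈ convexHull ℝ≥0 (uniformPOU s y₀)} ⊆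
      mixProb s '' {Q : ProbabilityMeasure (Pt m) | (Q : Measure (Pt m)) (tail s y₀) = 1} := by
    intro η hη
    obtain ⟨Q, hQ, hQt, hmix⟩ := convexHull_uniformPOU_subset s y₀ hη
    exact ⟨⟨Q, hQ⟩, hQt, Subtype.ext hmix⟩
  obtain ⟨Q, hQ, rfl⟩ := closure_minimal hsub (isClosed_mixtures s y₀) hν'
  exact ⟨Q, inferInstance, hQ, rfl⟩

/-! ### Mixtures are weak limits of convex combinations of uniform distributions -/

/-- The set is the box `[s, v₁] × ∏ [v_j, v_j + ε]`. Extending it only upwards from `v` keeps it in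
the tail region, and `s < v₁` gives it positive volume. -/
lemma exists_mix_mem_uniformPOU {s : ℝ} {y₀ : Fin m → EReal} {v : Pt m} (hv : v ∈ tail s y₀)
    (hs : s < v.1) {ε : ℝ} (hε : 0 < ε) :
    ∃ q : Measure (Pt m), IsProbabilityMeasure q ∧ (∀ᵐ z ∂q, dist z v ≤ ε) ∧
      mix s q ∈ uniformPOU s y₀ := by
  set B : Set (Fin m → ℝ) := Icc v.2 (fun j => v.2 j + ε) with hB
  set K : Set (Pt m) := Icc s v.1 ×ˢ B with hKdef
  have hK : IsPOUSet s y₀ K := by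
    refine ⟨measurableSet_Icc.prod measurableSet_Icc, ?_, ?_⟩
    · rintro x ⟨h1, h2⟩
      exact ⟨h1.1, fun j => (hv.2 j).trans (EReal.coe_le_coe_iff.2 (h2.1 j))⟩
    · rintro x ⟨h1, h2⟩ t ht htx
      exact ⟨⟨ht, htx.trans h1.2⟩, h2⟩
  have hvol : volume K = ENNReal.ofReal (v.1 - s) * ∏ _j : Fin m, ENNReal.ofReal ε := by
    rw [hKdef, Measure.volume_eq_prod, Measure.prod_prod, Real.volume_Icc, hB,
      Real.volume_Icc_pi]
    simp
  have h0 : volume K ≠ 0 := by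
    rw [hvol]
    refine mul_ne_zero (by simpa using hs) (Finset.prod_ne_zero_iff.2 fun j _ => by simpa using hε)
  have hfin : volume K ≠ ∞ := by
    rw [hvol]
    exact ENNReal.mul_ne_top ENNReal.ofReal_ne_top
      (ENNReal.prod_ne_top fun j _ => ENNReal.ofReal_ne_top)
  obtain ⟨q, hq, hqae, hmix⟩ := exists_mix_eq_cond hK h0 hfin
  refine ⟨q, hq, ?_, K, hK, h0, hfin, hmix⟩
  filter_upwards [hqae] with z hz
  obtain ⟨t, ht⟩ := nonempty_of_measure_ne_zero hz.1
  have hzB : z.2 ∈ B := ht.2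
  have hsec : {t : ℝ | (t, z.2) ∈ K} = Icc s v.1 := by
    ext t; exact ⟨fun h => h.1, fun h => ⟨h, hzB⟩⟩
  have h1 : z.1 = v.1 := by
    rw [hz.2, hsec, Real.volume_Icc, ENNReal.toReal_ofReal (sub_nonneg.2 hs.le)]; ring
  rw [Prod.dist_eq, h1, dist_self, max_le_iff]
  refine ⟨hε.le, (dist_pi_le_iff hε.le).2 fun j => ?_⟩
  have h2 := hzB.1 j
  have h3 := hzB.2 j
  rw [Real.dist_eq, abs_le]
  constructor <;> linarith

/-- Finite convex combinations with weights in `ℝ≥0`. -/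
lemma sum_smul_mem_of_convex {E ι : Type*} [AddCommMonoid E] [Module ℝ≥0 E] {C : Set E}
    (hC : Convex ℝ≥0 C) (t : Finset ι) (w : ι → ℝ≥0) (x : ι → E) (hw : ∑ i ∈ t, w i = 1)
    (hx : ∀ i ∈ t, x i ∈ C) : ∑ i ∈ t, w i • x i ∈ C := by
  classical
  induction t using Finset.induction_on generalizing w with
  | empty => simp at hw
  | insert a t ha ih =>
    rw [Finset.sum_insert ha] at hw ⊢
    have hxt : ∀ i ∈ t, x i ∈ C := fun i hi => hx i (Finset.mem_insert_of_mem hi)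
    by_cases hr : ∑ i ∈ t, w i = 0
    · have hz : ∀ i ∈ t, w i = 0 := Finset.sum_eq_zero_iff.1 hr
      rw [hr, add_zero] at hw
      rw [Finset.sum_eq_zero fun i hi => by rw [hz i hi, zero_smul], hw, one_smul, add_zero]
      exact hx a (Finset.mem_insert_self a t)
    · have h1 := ih (fun i => (∑ i ∈ t, w i)⁻¹ * w i)
        (by rw [← Finset.mul_sum, inv_mul_cancel₀ hr]) hxt
      have h2 := hC (hx a (Finset.mem_insert_self a t)) h1 zero_le zero_le hw
      rw [Finset.smul_sum] at h2
      simpa only [smul_smul, ← mul_assoc, mul_inv_cancel₀ hr, one_mul] using h2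

lemma tendsto_lintegral_of_concentrated {X : Type*} [PseudoMetricSpace X] [MeasurableSpace X]
    [BorelSpace X] {q : ℕ → Measure X}
    [∀ k, IsProbabilityMeasure (q k)] {v : ℕ → X} {z : X}
    (hv : Filter.Tendsto v Filter.atTop (nhds z))
    (hq : ∀ k, ∀ᵐ x ∂q k, dist x (v k) ≤ 1 / ((k : ℝ) + 1)) {g : X → ℝ≥0} (hg : Continuous g) :
    Filter.Tendsto (fun k => ∫⁻ x, g x ∂q k) Filter.atTop (nhds (g z : ℝ≥0∞)) := by
  rw [ENNReal.tendsto_nhds ENNReal.coe_ne_top]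
  intro ε hε
  have hgz : Filter.Tendsto (fun x => (g x : ℝ≥0∞)) (nhds z) (nhds (g z)) :=
    (ENNReal.continuous_coe.comp hg).tendsto z
  rw [ENNReal.tendsto_nhds ENNReal.coe_ne_top] at hgz
  obtain ⟨δ, hδ, hball⟩ := Metric.eventually_nhds_iff.1 (hgz ε hε)
  filter_upwards [Metric.tendsto_nhds.1 hv (δ / 2) (half_pos hδ),
    tendsto_one_div_add_atTop_nhds_zero_nat.eventually_lt_const (half_pos hδ)] with k hk1 hk2
  have hae : ∀ᵐ x ∂q k, (g x : ℝ≥0∞) ∈ Icc (g z - ε : ℝ≥0∞) (g z + ε) := by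
    filter_upwards [hq k] with x hx
    refine hball ((dist_triangle x (v k) z).trans_lt ?_)
    linarith
  constructor
  · calc (g z - ε : ℝ≥0∞) = ∫⁻ _, (g z - ε : ℝ≥0∞) ∂q k := by simp
      _ ≤ _ := lintegral_mono_ae (hae.mono fun x hx => hx.1)
  · calc _ ≤ ∫⁻ _, (g z + ε : ℝ≥0∞) ∂q k := lintegral_mono_ae (hae.mono fun x hx => hx.2)
      _ = _ := by simp

/-- Simple functions `F k → id` discretize `Q`; each atom `v` is then spread to a nearby `q k v`
whose mixture is uniform on a 1-POU box. The resulting laws `ρ k` tend weakly to `Q`, and continuity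
of mixing concludes. -/
lemma isPOU_mix {s : ℝ} {y₀ : Fin m → EReal} {Q : Measure (Pt m)} [IsProbabilityMeasure Q]
    (hQt : Q (tail s y₀) = 1) (hQs : ∀ᵐ z ∂Q, s < z.1) : IsPOU s y₀ (mix s Q) := by
  set A : Set (Pt m) := {z | z ∈ tail s y₀ ∧ s < z.1} with hA
  have hAae : ∀ᵐ z ∂Q, z ∈ A := by
    have h1 : ∀ᵐ z ∂Q, z ∈ tail s y₀ := (prob_compl_eq_zero_iff (measurableSet_tail s y₀)).2 hQt
    filter_upwards [h1, hQs] with z h1 h2 using ⟨h1, h2⟩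
  obtain ⟨z₀, hz₀⟩ := hAae.exists
  have hq : ∀ (k : ℕ) (v : Pt m), ∃ q : Measure (Pt m), IsProbabilityMeasure q ∧
      (v ∈ A → (∀ᵐ z ∂q, dist z v ≤ 1 / ((k : ℝ) + 1)) ∧ mix s q ∈ uniformPOU s y₀) := by
    intro k v
    by_cases hv : v ∈ A
    · obtain ⟨q, h1, h2⟩ := exists_mix_mem_uniformPOU hv.1 hv.2
        (show (0 : ℝ) < 1 / ((k : ℝ) + 1) by positivity)
      exact ⟨q, h1, fun _ => h2⟩
    -- An arbitrary value, so that `q k` is defined everywhere; `F k` takes values in `A` only.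
    · exact ⟨Measure.dirac v, inferInstance, fun h => absurd h hv⟩
  choose q hqp hq using hq
  set F : ℕ → SimpleFunc (Pt m) (Pt m) := SimpleFunc.approxOn id measurable_id A z₀ hz₀ with hF
  have hFA : ∀ k z, F k z ∈ A := fun k z => SimpleFunc.approxOn_mem measurable_id hz₀ k z
  set w : ℕ → Pt m → ℝ≥0 := fun k v => (Q (F k ⁻¹' {v})).toNNReal with hw
  have hwc : ∀ k v, (w k v : ℝ≥0∞) = Q (F k ⁻¹' {v}) := fun k v =>
    ENNReal.coe_toNNReal (measure_ne_top _ _)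
  have hwsum : ∀ k, ∑ v ∈ (F k).range, w k v = 1 := by
    intro k
    have : ((∑ v ∈ (F k).range, w k v : ℝ≥0) : ℝ≥0∞) = 1 := by
      rw [ENNReal.ofNNReal_finsetSum]
      simp_rw [hwc]
      rw [SimpleFunc.sum_range_measure_preimage_singleton, measure_univ]
    exact_mod_cast this
  set ρ : ℕ → Measure (Pt m) := fun k => ∑ v ∈ (F k).range, w k v • q k v with hρ
  have hRint : ∀ k (g : Pt m → ℝ≥0∞), ∫⁻ x, g x ∂(ρ k) = ∫⁻ z, ∫⁻ x, g x ∂q k (F k z) ∂Q := by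
    intro k g
    have h1 : ∫⁻ z, ∫⁻ x, g x ∂q k (F k z) ∂Q
        = ((F k).map fun v => ∫⁻ x, g x ∂q k v).lintegral Q :=
      SimpleFunc.lintegral_eq_lintegral ((F k).map fun v => ∫⁻ x, g x ∂q k v) Q
    rw [h1, SimpleFunc.map_lintegral, hρ, lintegral_finsetSum_measure]
    refine Finset.sum_congr rfl fun v _ => ?_
    rw [ENNReal.smul_def, lintegral_smul_measure, smul_eq_mul, hwc, mul_comm]
  have hRp : ∀ k, IsProbabilityMeasure (ρ k) := fun k => ⟨by
    have := hRint k (fun _ => 1)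
    simpa using this⟩
  have hRmix : ∀ k, mix s (ρ k) ∈ convexHull ℝ≥0 (uniformPOU s y₀) := by
    intro k
    rw [hρ, mix_sum]
    refine sum_smul_mem_of_convex (convex_convexHull _ _) _ _ _ (hwsum k) fun v hv => ?_
    obtain ⟨z, rfl⟩ := SimpleFunc.mem_range.1 hv
    exact subset_convexHull _ _ (hq k _ (hFA k z)).2
  let ρ' : ℕ → ProbabilityMeasure (Pt m) := fun k => ⟨ρ k, hRp k⟩
  let Q' : ProbabilityMeasure (Pt m) := ⟨Q, inferInstance⟩
  have hlim : Filter.Tendsto ρ' Filter.atTop (nhds Q') := by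
    rw [ProbabilityMeasure.tendsto_iff_forall_lintegral_tendsto]
    intro g
    simp only [ρ', Q', ProbabilityMeasure.coe_mk, hRint]
    refine tendsto_lintegral_of_dominated_convergence (fun _ => (nndist g 0 : ℝ≥0∞))
      (fun k => ?_) (fun k => ?_) (by simp) ?_
    · exact ((F k).map fun v => ∫⁻ x, g x ∂q k v).measurable
    · refine Filter.Eventually.of_forall fun z => ?_
      calc _ ≤ ∫⁻ _, (nndist g 0 : ℝ≥0∞) ∂q k (F k z) :=
            lintegral_mono fun x =>
              ENNReal.coe_le_coe.2 (BoundedContinuousFunction.NNReal.upper_bound g x)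
        _ = _ := by simp
    · filter_upwards [hAae] with z hz
      exact tendsto_lintegral_of_concentrated
        (SimpleFunc.tendsto_approxOn measurable_id hz₀ (subset_closure hz))
        (fun k => (hq k _ (hFA k z)).1) g.continuous
  refine ⟨mixProb s Q', rfl, ?_⟩
  exact mem_closure_of_tendsto (((continuous_mixProb s).tendsto _).comp hlim)
    (Filter.Eventually.of_forall fun k => hRmix k)

section FiniteDimensional

/-! ### Means of random vectors in convex sets, and reduction of the number of atoms -/

/-- A nontrivial linear functional that is almost surely constant, if the mean is not attained. -/
lemma exists_functional_ae_eq {Ω E : Type*} [MeasurableSpace Ω] {μ : Measure Ω}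
    [IsProbabilityMeasure μ] [NormedAddCommGroup E] [NormedSpace ℝ E] [FiniteDimensional ℝ E]
    {C : Set E} (hC : Convex ℝ C) {f : Ω → E} (hf : Integrable f μ) (hfC : ∀ᵐ ω ∂μ, f ω ∈ C)
    (h0 : ∫ ω, f ω ∂μ = 0) (hn : (0 : E) ∉ C) :
    ∃ φ : E →L[ℝ] ℝ, φ ≠ 0 ∧ ∀ᵐ ω ∂μ, φ (f ω) = 0 := by
  have hint : ∀ φ : E →L[ℝ] ℝ, ∫ ω, φ (f ω) ∂μ = 0 := fun φ => by
    rw [φ.integral_comp_comm hf, h0, map_zero]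
  by_cases hi : (interior C).Nonempty
  -- A hyperplane through `0` supports `C`; a functional of one sign with mean zero vanishes almost
  -- surely.
  · obtain ⟨φ, hφ, hle⟩ := geometric_hahn_banach_of_nonempty_interior_point hC
      (fun h => hn (interior_subset h)) hi
    refine ⟨φ, hφ, ?_⟩
    have hnn : 0 ≤ᵐ[μ] fun ω => -φ (f ω) := by
      filter_upwards [hfC] with ω hω
      simpa using hle _ hω
    have := (integral_eq_zero_iff_of_nonneg_ae hnn (φ.integrable_comp hf).neg).1
      (by rw [integral_neg, hint, neg_zero])
    filter_upwards [this] with ω hω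
    simpa using hω
  -- Without interior, `C` lies in a proper affine subspace. A functional killing its direction is
  -- almost surely constant, and the constant is its mean, zero.
  · have hne : affineSpan ℝ C ≠ ⊤ := fun h =>
      hi ((hC.interior_nonempty_iff_affineSpan_eq_top).2 h)
    obtain ⟨ω₀, hω₀⟩ := hfC.exists
    have hdir : (affineSpan ℝ C).direction < ⊤ := by
      rw [lt_top_iff_ne_top]
      intro h
      exact hne ((AffineSubspace.direction_eq_top_iff_of_nonempty
        ⟨_, subset_affineSpan ℝ C hω₀⟩).1 h)
    obtain ⟨ψ, hψ, hker⟩ := Submodule.exists_le_ker_of_lt_top _ hdir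
    refine ⟨LinearMap.toContinuousLinearMap ψ, fun h => hψ ?_, ?_⟩
    · ext x
      simpa using congrArg (fun g : E →L[ℝ] ℝ => g x) h
    · have hconst : ∀ᵐ ω ∂μ, (LinearMap.toContinuousLinearMap ψ) (f ω) = ψ (f ω₀) := by
        filter_upwards [hfC] with ω hω
        have : f ω -ᵥ f ω₀ ∈ (affineSpan ℝ C).direction :=
          AffineSubspace.vsub_mem_direction (subset_affineSpan ℝ C hω) (subset_affineSpan ℝ C hω₀)
        have h2 := hker this
        rw [LinearMap.mem_ker, vsub_eq_sub, map_sub, sub_eq_zero] at h2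
        exact h2
      have h3 := hint (LinearMap.toContinuousLinearMap ψ)
      rw [integral_congr_ae hconst] at h3
      filter_upwards [hconst] with ω hω
      rw [hω]
      simpa using h3

/-- In finite dimension the mean of an integrable random vector lies in every convex set that
carries it, closed or not. -/
lemma zero_mem_of_integral_eq_zero (d : ℕ) : ∀ {Ω E : Type*} [MeasurableSpace Ω] {μ : Measure Ω}
    [IsProbabilityMeasure μ] [NormedAddCommGroup E] [NormedSpace ℝ E] [FiniteDimensional ℝ E]
    {C : Set E} (_ : Module.finrank ℝ E = d) (_ : Convex ℝ C) {f : Ω → E} (_ : Integrable f μ)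
    (_ : ∀ᵐ ω ∂μ, f ω ∈ C) (_ : ∫ ω, f ω ∂μ = 0), (0 : E) ∈ C := by
  induction d using Nat.strong_induction_on with
  | _ d ih =>
  intro Ω E _ μ _ _ _ _ C hd hC f hf hfC h0
  by_contra hn
  obtain ⟨φ, hφ, hae⟩ := exists_functional_ae_eq hC hf hfC h0 hn
  set V : Submodule ℝ E := LinearMap.ker (φ : E →ₗ[ℝ] ℝ) with hV
  have hlt : Module.finrank ℝ V < d := by
    rw [← hd]
    refine Submodule.finrank_lt fun htop => hφ ?_
    ext x
    have : x ∈ V := by rw [htop]; trivial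
    simpa [hV] using this
  -- Almost surely `f` lies in the hyperplane `V`; projecting makes it `V`-valued everywhere, so
  -- that the induction hypothesis applies to `C ∩ V`.
  obtain ⟨π, hπ⟩ := V.exists_isCompl.elim fun W hW => (⟨V.projectionOnto W hW, fun x =>
    Submodule.projectionOnto_apply_left hW x⟩ : ∃ π : E →ₗ[ℝ] V, ∀ x : V, π x = x)
  set π' : E →L[ℝ] V := LinearMap.toContinuousLinearMap π with hπ'
  have h := ih _ hlt (E := V) (C := V.subtype ⁻¹' C) (μ := μ) rfl
    (hC.linear_preimage V.subtype) (f := fun ω => π' (f ω)) (π'.integrable_comp hf) ?_ ?_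
  · exact hn (by simpa using h)
  · filter_upwards [hae, hfC] with ω h1 h2
    have hmem : f ω ∈ V := by simpa [hV] using h1
    have h3 : π' (f ω) = ⟨f ω, hmem⟩ := hπ ⟨f ω, hmem⟩
    simpa [h3] using h2
  · rw [π'.integral_comp_comm hf, h0, map_zero]

lemma integral_mem_of_convex {Ω E : Type*} [MeasurableSpace Ω] {μ : Measure Ω}
    [IsProbabilityMeasure μ] [NormedAddCommGroup E] [NormedSpace ℝ E] [FiniteDimensional ℝ E]
    {C : Set E} (hC : Convex ℝ C) {f : Ω → E} (hf : Integrable f μ) (hfC : ∀ᵐ ω ∂μ, f ω ∈ C) :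
    ∫ ω, f ω ∂μ ∈ C := by
  have h := zero_mem_of_integral_eq_zero _ (μ := μ) (C := (fun x => (∫ ω, f ω ∂μ) + x) ⁻¹' C) rfl
    (hC.translate_preimage_right _) (f := fun ω => f ω - ∫ ω, f ω ∂μ)
    (hf.sub (integrable_const _)) ?_ ?_
  · simpa using h
  · filter_upwards [hfC] with ω hω
    simpa using hω
  · rw [integral_sub hf (integrable_const _)]
    simp

/-- One step of the simplex method: with more atoms than linear constraints, one of the weights can
be made zero without decreasing the objective. -/
lemma exists_weights_with_zero {ι E : Type*} [Fintype ι] [AddCommGroup E] [Module ℝ E]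
    [FiniteDimensional ℝ E] (x : ι → E) (r w : ι → ℝ) (hw : ∀ i, 0 < w i)
    (hcard : Module.finrank ℝ E + 1 < Fintype.card ι) :
    ∃ w' : ι → ℝ, (∀ i, 0 ≤ w' i) ∧ (∃ i, w' i = 0) ∧ ∑ i, w' i = ∑ i, w i ∧
      ∑ i, w' i • x i = ∑ i, w i • x i ∧ ∑ i, w i * r i ≤ ∑ i, w' i * r i := by
  obtain ⟨a, ha1, ha0, haor, hane⟩ : ∃ a : ι → ℝ, ∑ i, a i • x i = 0 ∧ ∑ i, a i = 0 ∧
      0 ≤ ∑ i, a i * r i ∧ ∃ i, a i ≠ 0 := by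
    -- The extra coordinate `1` makes the dependence preserve total mass. Its sign is then chosen so
    -- that the objective does not decrease.
    have hdep : ¬ LinearIndependent ℝ (fun i => ((1 : ℝ), x i)) := fun h => by
      have := h.fintype_card_le_finrank
      rw [Module.finrank_prod, Module.finrank_self] at this
      omega
    obtain ⟨a, ha, hane⟩ := Fintype.not_linearIndependent_iff.1 hdep
    have e1 : ∑ i, a i = 0 := by
      have := congrArg Prod.fst ha
      simpa [Prod.fst_sum] using this
    have e2 : ∑ i, a i • x i = 0 := by
      have := congrArg Prod.snd ha
      simpa [Prod.snd_sum] using this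
    rcases le_total 0 (∑ i, a i * r i) with h | h
    · exact ⟨a, e2, e1, h, hane⟩
    · refine ⟨-a, ?_, ?_, ?_, ?_⟩
      · simp [e2]
      · simp [e1]
      · simpa using h
      · simpa using hane
  have hneg : (Finset.univ.filter fun i => a i < 0).Nonempty := by
    by_contra hcon
    rw [Finset.not_nonempty_iff_eq_empty, Finset.filter_eq_empty_iff] at hcon
    obtain ⟨i, hi⟩ := hane
    have := (Finset.sum_eq_zero_iff_of_nonneg fun i _ => not_lt.1 (hcon (Finset.mem_univ i))).1 ha0
    exact hi (this i (Finset.mem_univ i))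
  obtain ⟨k, hk, hmin⟩ := Finset.exists_min_image _ (fun i => w i / -a i) hneg
  have hk : a k < 0 := by simpa using hk
  -- The largest step for which all weights `w + τ a` stay nonnegative; the weight at `k` reaches
  -- zero.
  set τ := w k / -a k with hτ
  have hτ0 : 0 ≤ τ := div_nonneg (hw k).le (by linarith)
  refine ⟨fun i => w i + τ * a i, fun i => ?_, ⟨k, ?_⟩, ?_, ?_, ?_⟩
  · rcases le_or_gt 0 (a i) with hi | hi
    · have := mul_nonneg hτ0 hi
      linarith [hw i]
    · have := hmin i (by simpa using hi)
      rw [le_div_iff₀ (by linarith)] at this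
      linarith
  · have : a k ≠ 0 := hk.ne
    simp only [hτ]
    field_simp
    ring
  · rw [Finset.sum_add_distrib, ← Finset.mul_sum, ha0, mul_zero, add_zero]
  · simp_rw [add_smul, mul_smul]
    rw [Finset.sum_add_distrib, ← Finset.smul_sum, ha1, smul_zero, add_zero]
  · simp_rw [add_mul, mul_assoc]
    rw [Finset.sum_add_distrib, ← Finset.mul_sum]
    have := mul_nonneg hτ0 haor
    linarith

/-- A finite family of atoms can be listed with any larger number of atoms. -/
lemma exists_fin_reindex {ι Z : Type*} [Fintype ι] {N : ℕ} (hN : Fintype.card ι ≤ N) (w : ι → ℝ)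
    (hw : ∀ i, 0 ≤ w i) (z : ι → Z) (T : Set Z) (hz : ∀ i, z i ∈ T) (hT : T.Nonempty) :
    ∃ (p : Fin N → ℝ) (y : Fin N → Z), (∀ l, 0 ≤ p l) ∧ (∀ l, y l ∈ T) ∧
      ∀ {E : Type} [AddCommGroup E] [Module ℝ E] (x : Z → E),
        ∑ l, p l • x (y l) = ∑ i, w i • x (z i) := by
  obtain ⟨z₀, hz₀⟩ := hT
  obtain ⟨e⟩ : Nonempty (ι ↪ Fin N) := Function.Embedding.nonempty_of_card_le (by simpa using hN)
  refine ⟨Function.extend e w 0, Function.extend e z fun _ => z₀, fun l => ?_, fun l => ?_, ?_⟩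
  · by_cases h : ∃ i, e i = l
    · obtain ⟨i, rfl⟩ := h
      rw [e.injective.extend_apply]; exact hw i
    · rw [Function.extend_apply' _ _ _ h]; rfl
  · by_cases h : ∃ i, e i = l
    · obtain ⟨i, rfl⟩ := h
      rw [e.injective.extend_apply]; exact hz i
    · rw [Function.extend_apply' _ _ _ h]; exact hz₀
  · intro E _ _ x
    symm
    refine Fintype.sum_of_injective e e.injective _ _ (fun l hl => ?_) fun i => ?_
    · rw [Function.extend_apply' _ _ _ hl]; simp
    · rw [e.injective.extend_apply, e.injective.extend_apply]

/-- Finitely many moments of a probability measure are matched, and a further one is not decreased,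
by a measure with one atom more than there are matched moments. -/
lemma exists_atoms_of_integral {Z : Type*} [MeasurableSpace Z] {Q : Measure Z}
    [IsProbabilityMeasure Q] {T : Set Z} (hT : ∀ᵐ z ∂Q, z ∈ T) {E : Type} [NormedAddCommGroup E]
    [NormedSpace ℝ E] [FiniteDimensional ℝ E] {x : Z → E} {r : Z → ℝ} (hx : Integrable x Q)
    (hr : Integrable r Q) {N : ℕ} (hN : Module.finrank ℝ E + 1 = N) :
    ∃ (p : Fin N → ℝ) (y : Fin N → Z), (∀ l, 0 ≤ p l) ∧ (∀ l, y l ∈ T) ∧ ∑ l, p l = 1 ∧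
      ∑ l, p l • x (y l) = ∫ z, x z ∂Q ∧ ∫ z, r z ∂Q ≤ ∑ l, p l * r (y l) := by
  have hmem : ∫ z, (x z, r z) ∂Q ∈ convexHull ℝ ((fun z => (x z, r z)) '' T) :=
    integral_mem_of_convex (convex_convexHull ℝ _) (hx.prodMk hr) (by
      filter_upwards [hT] with z hz using subset_convexHull ℝ _ (mem_image_of_mem _ hz))
  rw [integral_pair hx hr] at hmem
  obtain ⟨ι, _, v, w, hv, hind, hw, hw1, hsum⟩ := eq_pos_convex_span_of_mem_convexHull hmem
  choose z hzT hzv using fun i => hv (mem_range_self i)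
  -- Carathéodory in `E × ℝ`, of dimension `N`, allows one atom too many; since `r` need only not
  -- decrease, a simplex step removes it.
  have hcard : Fintype.card ι ≤ N + 1 := by
    have h1 := hind.card_le_finrank_succ
    have h2 := Submodule.finrank_le (vectorSpan ℝ (range v))
    rw [Module.finrank_prod, Module.finrank_self] at h2
    omega
  have hs1 : ∑ i, w i • x (z i) = ∫ z, x z ∂Q := by
    have := congrArg Prod.fst hsum
    simpa [Prod.fst_sum, ← hzv] using this
  have hs2 : ∑ i, w i * r (z i) = ∫ z, r z ∂Q := by
    have := congrArg Prod.snd hsum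
    simpa [Prod.snd_sum, ← hzv] using this
  have hTne : T.Nonempty := hT.exists
  obtain ⟨κ, _, w', z', hκ, hw', hz', h1, h2, h3⟩ : ∃ (κ : Type) (_ : Fintype κ) (w' : κ → ℝ)
      (z' : κ → Z), Fintype.card κ ≤ N ∧ (∀ i, 0 ≤ w' i) ∧ (∀ i, z' i ∈ T) ∧ ∑ i, w' i = 1 ∧
      ∑ i, w' i • x (z' i) = ∫ z, x z ∂Q ∧ ∫ z, r z ∂Q ≤ ∑ i, w' i * r (z' i) := by
    by_cases hle : Fintype.card ι ≤ N
    · exact ⟨ι, _, w, z, hle, fun i => (hw i).le, hzT, hw1, hs1, hs2.ge⟩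
    · classical
      obtain ⟨w', hw', ⟨k, hk⟩, h1, h2, h3⟩ := exists_weights_with_zero (fun i => x (z i))
        (fun i => r (z i)) w hw (by omega)
      have hsub : ∀ {F : Type} [AddCommGroup F] (g : ι → F), g k = 0 →
          ∑ i : {i // i ≠ k}, g i = ∑ i, g i := fun g hg => by
        rw [Fintype.sum_eq_add_sum_subtype_ne g k, hg, zero_add]
      refine ⟨{i // i ≠ k}, inferInstance, fun i => w' i, fun i => z i, ?_, fun i => hw' i,
        fun i => hzT i, ?_, ?_, ?_⟩
      · rw [Fintype.card_subtype_compl, Fintype.card_subtype_eq]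
        omega
      · rw [hsub w' hk, h1, hw1]
      · rw [hsub (fun i => w' i • x (z i)) (by simp [hk]), h2, hs1]
      · rw [hsub (fun i => w' i * r (z i)) (by simp [hk]), ← hs2]
        exact h3
  obtain ⟨p, y, hp, hy, hpy⟩ := exists_fin_reindex hκ w' hw' z' T hz' hTne
  refine ⟨p, y, hp, hy, ?_, ?_, ?_⟩
  · simpa using (hpy fun _ => (1 : ℝ)).trans (by simpa using h1)
  · rw [hpy, h2]
  · simpa using h3.trans_eq (by simpa using (hpy r).symm)

end FiniteDimensional

variable {n : ℕ}

namespace Data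

variable (D : Data m n)

/-! ### The kernels of the moment problem -/

lemma measurableSet_D₀ : MeasurableSet D.D₀ := measurableSet_tail D.s D.y₀

/-- The condition of the `i`-th box, as a set of values of the coordinates `2, …, d`. -/
def sideSet (i : Fin n) : Set (Fin m → ℝ) :=
  {y | ∀ j, D.lo i j ≤ (y j : EReal) ∧ (y j : EReal) ≤ D.hi i j}

lemma measurableSet_sideSet (i : Fin n) : MeasurableSet (D.sideSet i) := by
  have : D.sideSet i = {y | ∀ j, D.lo i j ≤ (y j : EReal)} ∩
      ⋂ j, {y : Fin m → ℝ | (y j : EReal) ≤ D.hi i j} := by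
    ext y; simp [sideSet, forall_and]
  rw [this]
  exact (measurableSet_ge _).inter (MeasurableSet.iInter fun j => measurableSet_le
    (measurable_coe_real_ereal.comp (measurable_pi_apply j)) measurable_const)

lemma momKernel_eq (i : Fin n) (z : Pt m) : D.momKernel i z =
    (cap (D.hi₁ i) z.1 - cap (D.lo₁ i) z.1) / (z.1 - D.s) * (D.sideSet i).indicator 1 z.2 := by
  rw [cap_coe]; rfl

lemma measurable_momKernel (i : Fin n) : Measurable (D.momKernel i) := by
  have : D.momKernel i = fun z => (cap (D.hi₁ i) z.1 - cap (D.lo₁ i) z.1) / (z.1 - D.s) *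
      (D.sideSet i).indicator 1 z.2 := funext (D.momKernel_eq i)
  rw [this]
  exact (((measurable_cap (e := fun _ => D.hi₁ i) measurable_const).sub
    (measurable_cap (e := fun _ => (D.lo₁ i : EReal)) measurable_const)).div
    (measurable_fst.sub_const _)).mul
    ((measurable_one.indicator (D.measurableSet_sideSet i)).comp measurable_snd)

lemma measurable_objKernel : Measurable D.objKernel :=
  ((measurable_cap D.measurable_g₂).sub (measurable_cap D.measurable_g₁)).div
    (measurable_fst.sub_const _)

lemma abs_objKernel_le {z : Pt m} (hz : z ∈ D.D₀) (hs : D.s < z.1) : |D.objKernel z| ≤ 1 := by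
  have := cap_ratio_mem hs (D.le_g₁ _ hz.2) (D.g₁_le_g₂ _ hz.2)
  rw [objKernel, abs_of_nonneg this.1]
  exact this.2

lemma abs_momKernel_le (i : Fin n) {z : Pt m} (hs : D.s < z.1) : |D.momKernel i z| ≤ 1 := by
  have := cap_ratio_mem hs (EReal.coe_le_coe_iff.2 (D.s_le_lo₁ i)) (D.lo₁_le_hi₁ i)
  rw [momKernel_eq, abs_mul, abs_of_nonneg this.1]
  refine mul_le_one₀ this.2 (abs_nonneg _) ?_
  by_cases h : z.2 ∈ D.sideSet i <;> simp [h]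

section Integrals

variable {Q : Measure (Pt m)} [IsProbabilityMeasure Q]

lemma integrable_objKernel (h0 : ∀ᵐ z ∂Q, z ∈ D.D₀) (hs : ∀ᵐ z ∂Q, D.s < z.1) :
    Integrable D.objKernel Q := by
  refine Integrable.of_bound D.measurable_objKernel.aestronglyMeasurable 1 ?_
  filter_upwards [h0, hs] with z h1 h2 using D.abs_objKernel_le h1 h2

lemma integrable_momKernel (i : Fin n) (hs : ∀ᵐ z ∂Q, D.s < z.1) :
    Integrable (D.momKernel i) Q := by
  refine Integrable.of_bound (D.measurable_momKernel i).aestronglyMeasurable 1 ?_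
  filter_upwards [hs] with z h2 using D.abs_momKernel_le i h2

lemma box_eq (i : Fin n) : D.box i = {x | ((D.lo₁ i : EReal) ≤ (x.1 : EReal) ∧
    (x.1 : EReal) ≤ D.hi₁ i) ∧ x.2 ∈ D.sideSet i} := by
  ext x
  simp only [box, mem_ofPred_eq, EReal.coe_le_coe_iff]
  rfl

lemma box_subset (i : Fin n) : D.box i ⊆ D.D₀ := fun _ hx =>
  ⟨(D.s_le_lo₁ i).trans hx.1.1, fun j => (D.y₀_le_lo i j).trans (hx.2 j).1⟩

lemma S_eq : D.S = {x | (D.g₁ x.2 ≤ (x.1 : EReal) ∧ (x.1 : EReal) ≤ D.g₂ x.2) ∧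
    x.2 ∈ {y : Fin m → ℝ | ∀ j, D.y₀ j ≤ (y j : EReal)}} := by
  ext x
  refine ⟨fun h => ⟨h.2, h.1.2⟩, fun h => ⟨⟨?_, h.2⟩, h.1⟩⟩
  exact EReal.coe_le_coe_iff.1 ((D.le_g₁ _ h.2).trans h.1.1)

lemma mix_real_box (i : Fin n) (hs : ∀ᵐ z ∂Q, D.s < z.1) :
    (mix D.s Q).real (D.box i) = ∫ z, D.momKernel i z ∂Q := by
  rw [box_eq, integral_congr_ae (Filter.Eventually.of_forall (D.momKernel_eq i))]
  exact mix_real_region D.s Q hs (e₁ := fun _ => (D.lo₁ i : EReal)) (e₂ := fun _ => D.hi₁ i)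
    measurable_const measurable_const (D.measurableSet_sideSet i)
    (fun _ _ => EReal.coe_le_coe_iff.2 (D.s_le_lo₁ i)) (fun _ _ => D.lo₁_le_hi₁ i)

lemma mix_real_S (h0 : ∀ᵐ z ∂Q, z ∈ D.D₀) (hs : ∀ᵐ z ∂Q, D.s < z.1) :
    (mix D.s Q).real D.S = ∫ z, D.objKernel z ∂Q := by
  rw [S_eq, mix_real_region D.s Q hs D.measurable_g₁ D.measurable_g₂ (measurableSet_ge _)
    D.le_g₁ D.g₁_le_g₂]
  refine integral_congr_ae ?_
  filter_upwards [h0] with z hz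
  rw [indicator_of_mem (show z.2 ∈ {y : Fin m → ℝ | ∀ j, D.y₀ j ≤ (y j : EReal)} from hz.2),
    Pi.one_apply, mul_one]
  rfl

lemma mix_mode (hs : ∀ᵐ z ∂Q, D.s < z.1) : mix D.s Q {x | x.1 = D.s} = 0 := by
  have hmeas : MeasurableSet {x : Pt m | x.1 = D.s} := measurable_fst (measurableSet_singleton D.s)
  rw [mix_apply _ _ hmeas, lintegral_congr_ae
    (g := fun _ => 0)]
  · simp
  · filter_upwards [hs] with z hz
    have : {u ∈ Ioo (0 : ℝ) 1 | D.s + u * (z.1 - D.s) = D.s} = ∅ := by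
      ext u
      simp only [mem_ofPred_eq, mem_empty_iff_false, iff_false, not_and, mem_Ioo]
      intro hu h
      have := mul_pos hu.1 (sub_pos.2 hz)
      linarith
    exact (congrArg volume this).trans measure_empty

end Integrals

lemma ae_mem_D₀ {Q : Measure (Pt m)} [IsProbabilityMeasure Q] (h : Q D.D₀ = 1) :
    ∀ᵐ z ∂Q, z ∈ D.D₀ := (prob_compl_eq_zero_iff D.measurableSet_D₀).2 h

/-! ### The DRO problem and the moment problem -/

section Recovers

variable {D} {c : ℝ} {Q P : Measure (Pt m)}

lemma Recovers.real_eq (h : D.Recovers c Q P) (hc : 0 ≤ c) {A : Set (Pt m)} (hA : A ⊆ D.D₀) :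
    P.real A = c * (mix D.s Q).real A := by
  rw [Measure.real, ← Measure.restrict_eq_self P hA, h.2, Measure.smul_apply, smul_eq_mul,
    ENNReal.toReal_mul, ENNReal.toReal_ofReal hc, Measure.real]

lemma exists_recovers (D : Data m n) (hc : 0 ≤ c) (hc1 : c ≤ 1) (Q : Measure (Pt m))
    [IsProbabilityMeasure Q] (hQ : Q D.D₀ = 1) : ∃ P, D.Recovers c Q P := by
  -- The remaining mass `1 - c` is placed at this point outside the tail region.
  have hx : ((D.s - 1, 0) : Pt m) ∉ D.D₀ := fun h => by
    have : D.s ≤ D.s - 1 := h.1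
    linarith
  refine ⟨ENNReal.ofReal c • mix D.s Q + ENNReal.ofReal (1 - c) • Measure.dirac (D.s - 1, 0),
    ⟨?_⟩, ?_⟩
  · rw [Measure.add_apply, Measure.smul_apply, Measure.smul_apply, measure_univ, measure_univ,
      smul_eq_mul, smul_eq_mul, mul_one, mul_one, ← ENNReal.ofReal_add hc (sub_nonneg.2 hc1),
      add_sub_cancel, ENNReal.ofReal_one]
  · rw [Measure.restrict_add, Measure.restrict_smul, Measure.restrict_smul]
    classical
    rw [restrict_dirac' D.measurableSet_D₀, if_neg hx, smul_zero, add_zero,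
      Measure.restrict_eq_self_of_ae_mem]
    exact mix_tail_compl D.s D.y₀ Q hQ

lemma moment_ae_lt (hQ : Q ∈ (D.moment c).feasible) : ∀ᵐ z ∂Q, D.s < z.1 := by
  obtain ⟨hp, -, hinv, -⟩ := hQ
  exact D.ae_lt_of_lintegral_invKernel (hinv.trans_lt ENNReal.ofReal_lt_top).ne

lemma moment_ae_mem (hQ : Q ∈ (D.moment c).feasible) : ∀ᵐ z ∂Q, z ∈ D.D₀ := by
  obtain ⟨hp, h0, -⟩ := hQ
  exact D.ae_mem_D₀ h0

/-- The constraints and the objective see `P` only through its restriction to `𝒟₀`, which is `c`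
times the mixture. -/
lemma Recovers.constraints (hc : 0 < c) (hQ : Q ∈ (D.moment c).feasible) (h : D.Recovers c Q P) :
    P.real D.D₀ = c ∧ D.Constraints P ∧ P.real D.S = c * ∫ z, D.objKernel z ∂Q := by
  have hs := moment_ae_lt hQ
  have hm := moment_ae_mem hQ
  obtain ⟨hp, h0, hinv, hmom⟩ := hQ
  have hc' : ENNReal.ofReal c ≠ 0 := by simpa using hc
  have hD : P.real D.D₀ = c := by
    rw [h.real_eq hc.le subset_rfl, Measure.real, D₀, mix_tail D.s D.y₀ Q h0]
    simp
  have hPD : P D.D₀ = ENNReal.ofReal c := by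
    rw [← Measure.restrict_apply_self, h.2, Measure.smul_apply, D₀, mix_tail D.s D.y₀ Q h0]
    simp
  refine ⟨hD, ⟨?_, fun i => ?_, ?_, ?_⟩, ?_⟩
  · exact D.exists_isMarginalDensity hc hs h.2 hinv
  · rw [hD, h.real_eq hc.le (D.box_subset i), D.mix_real_box i hs, mul_comm _ c, mul_comm _ c]
    exact ⟨mul_le_mul_of_nonneg_left (hmom i).1 hc.le, mul_le_mul_of_nonneg_left (hmom i).2 hc.le⟩
  · have : ProbabilityTheory.cond P D.D₀ = mix D.s Q := by
      rw [ProbabilityTheory.cond, hPD, h.2, smul_smul,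
        ENNReal.inv_mul_cancel hc' ENNReal.ofReal_ne_top, one_smul]
    rw [this]
    exact isPOU_mix h0 hs
  · have hset : {x : Pt m | x ∈ D.D₀ ∧ x.1 = D.s} = {x | x.1 = D.s} ∩ D.D₀ := by
      ext x; exact and_comm
    have hmeas : MeasurableSet {x : Pt m | x.1 = D.s} :=
      measurable_fst (measurableSet_singleton D.s)
    rw [hset, ← Measure.restrict_apply hmeas, h.2,
      Measure.smul_apply, D.mix_mode hs, smul_zero]
  · rw [h.real_eq hc.le (fun x hx => hx.1), D.mix_real_S hm hs]

/-- Conditioning on a null set gives the zero measure, which is not a probability law, so the 1-POU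
constraint already contains `P(X ∈ 𝒟₀) > 0`. -/
lemma Constraints.real_pos [IsProbabilityMeasure P] (h : D.Constraints P) : 0 < P.real D.D₀ := by
  obtain ⟨-, -, ⟨ν, hν, -⟩, -⟩ := h
  refine ENNReal.toReal_pos (fun h0 => ?_) (measure_ne_top _ _)
  have h1 : (ν : Measure (Pt m)) univ = 1 := measure_univ
  rw [hν, ProbabilityTheory.cond_eq_zero_of_meas_eq_zero h0] at h1
  simp at h1

lemma Constraints.exists_moment [IsProbabilityMeasure P] (h : D.Constraints P) :
    ∃ Q ∈ (D.moment (P.real D.D₀)).feasible, D.Recovers (P.real D.D₀) Q P := by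
  have hpos := h.real_pos
  set c := P.real D.D₀ with hcdef
  have hPD : ENNReal.ofReal c = P D.D₀ := ENNReal.ofReal_toReal (measure_ne_top _ _)
  have hc' : P D.D₀ ≠ 0 := by rw [← hPD]; simpa using hpos
  obtain ⟨⟨f, hf, hfs⟩, hbox, hPOU, -⟩ := h
  obtain ⟨Q, hQ, hQ0, hmix⟩ := hPOU.exists_mix
  have hrec : D.Recovers c Q P := by
    refine ⟨inferInstance, ?_⟩
    rw [hmix, hPD, ProbabilityTheory.cond, smul_smul, ENNReal.mul_inv_cancel hc'
      (measure_ne_top _ _), one_smul]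
  have hm : ∀ᵐ z ∂Q, z ∈ D.D₀ := D.ae_mem_D₀ hQ0
  -- The density bound comes first: it gives `Z₁ > s` almost surely, which the box formula needs.
  have hinv := D.lintegral_invKernel_le hpos (hm.mono fun z hz => hz.1) hrec.2 hf hfs
  have hs := D.ae_lt_of_lintegral_invKernel (hinv.trans_lt ENNReal.ofReal_lt_top).ne
  refine ⟨Q, ⟨hQ, hQ0, hinv, fun i => ?_⟩, hrec⟩
  have := hbox i
  rw [hrec.real_eq hpos.le (D.box_subset i), D.mix_real_box i hs, ← hcdef, mul_comm _ c,
    mul_comm _ c] at this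
  exact ⟨le_of_mul_le_mul_left this.1 hpos, le_of_mul_le_mul_left this.2 hpos⟩

end Recovers

/-! ### The moment problem and the nonlinear program -/

section Discrete

variable {N : ℕ} {p : Fin N → ℝ} {z : Fin N → Pt m}

lemma integral_discrete (hp : ∀ l, 0 ≤ p l) (f : Pt m → ℝ) :
    ∫ x, f x ∂discrete p z = ∑ l, p l * f (z l) := by
  rw [discrete, integral_finsetSum_measure
    fun l _ => (integrable_dirac (by simp)).smul_measure ENNReal.ofReal_ne_top]
  refine Finset.sum_congr rfl fun l _ => ?_
  rw [integral_smul_measure, integral_dirac, ENNReal.toReal_ofReal (hp l), smul_eq_mul]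

lemma lintegral_discrete (f : Pt m → ℝ≥0∞) :
    ∫⁻ x, f x ∂discrete p z = ∑ l, ENNReal.ofReal (p l) * f (z l) := by
  simp [discrete, lintegral_finsetSum_measure]

end Discrete

variable {D} {c : ℝ}

lemma NLPConstraints.moment_feasible {p : Fin (n + 2) → ℝ} {z : Fin (n + 2) → Pt m}
    (h : D.NLPConstraints c p z) : discrete p z ∈ (D.moment c).feasible := by
  obtain ⟨hinv, hmom, hsum, hp, hz⟩ := h
  have hsum' : ∑ l, ENNReal.ofReal (p l) = 1 := by
    rw [← ENNReal.ofReal_sum_of_nonneg fun l _ => hp l, hsum, ENNReal.ofReal_one]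
  refine ⟨⟨?_⟩, ?_, ?_, fun i => ?_⟩
  · simpa [discrete] using hsum'
  · simpa [discrete, hz] using hsum'
  · rwa [lintegral_discrete]
  · rw [integral_discrete hp]
    exact hmom i

/-- The inverse kernel and the `n` box kernels are `n + 1` matched moments, hence `n + 2` atoms.
Choosing the atoms with `z₁ > s` keeps the inverse kernel finite, so it can be treated as a real
moment. -/
lemma exists_nlp_of_moment {Q : Measure (Pt m)} (hQ : Q ∈ (D.moment c).feasible) :
    ∃ w ∈ (D.nlp c).feasible, ∫ z, D.objKernel z ∂Q ≤ ∑ l, w.1 l * D.objKernel (w.2 l) := by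
  have hs := moment_ae_lt hQ
  have hm := moment_ae_mem hQ
  obtain ⟨hQp, hQ0, hinv, hmom⟩ := hQ
  set T : Set (Pt m) := {z | z ∈ D.D₀ ∧ D.s < z.1} with hT
  have hinvfin : ∫⁻ z, D.invKernel z ∂Q ≠ ∞ := (hinv.trans_lt ENNReal.ofReal_lt_top).ne
  have hinvint : Integrable (fun z => (D.invKernel z).toReal) Q :=
    integrable_toReal_of_lintegral_ne_top D.measurable_invKernel.aemeasurable hinvfin
  have hmomint : Integrable (fun z i => D.momKernel i z) Q :=
    Integrable.of_eval fun i => D.integrable_momKernel i hs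
  obtain ⟨p, z, hp, hz, hp1, hx, hr⟩ := exists_atoms_of_integral (Q := Q) (T := T)
    (by filter_upwards [hs, hm] with z h1 h2 using ⟨h2, h1⟩) (E := ℝ × (Fin n → ℝ))
    (hinvint.prodMk hmomint) (D.integrable_objKernel hm hs) (N := n + 2)
    (by rw [Module.finrank_prod, Module.finrank_self, Module.finrank_fin_fun]; omega)
  rw [integral_pair hinvint hmomint] at hx
  have hx1 : ∑ l, p l * (D.invKernel (z l)).toReal = ∫ z, (D.invKernel z).toReal ∂Q := by
    have := congrArg Prod.fst hx
    simpa [Prod.fst_sum] using this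
  have hx2 : ∀ i, ∑ l, p l * D.momKernel i (z l) = ∫ z, D.momKernel i z ∂Q := fun i => by
    have h2 := congrFun (congrArg Prod.snd hx) i
    dsimp only at h2
    rw [eval_integral fun i => D.integrable_momKernel i hs] at h2
    simpa [Prod.snd_sum] using h2
  refine ⟨(p, z), ⟨?_, fun i => ?_, hp1, hp, fun l => (hz l).1⟩, hr⟩
  · have hfin : ∀ l, D.invKernel (z l) ≠ ∞ := fun l => by
      simpa [invKernel] using (hz l).2
    calc ∑ l, ENNReal.ofReal (p l) * D.invKernel (z l)
        = ENNReal.ofReal (∑ l, p l * (D.invKernel (z l)).toReal) := by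
          rw [ENNReal.ofReal_sum_of_nonneg fun l _ => mul_nonneg (hp l) ENNReal.toReal_nonneg]
          refine Finset.sum_congr rfl fun l _ => ?_
          rw [ENNReal.ofReal_mul (hp l), ENNReal.ofReal_toReal (hfin l)]
      _ = ∫⁻ z, D.invKernel z ∂Q := by
          rw [hx1, integral_toReal D.measurable_invKernel.aemeasurable
            (ae_lt_top D.measurable_invKernel hinvfin), ENNReal.ofReal_toReal hinvfin]
      _ ≤ _ := hinv
  · simp only [hx2]
    exact hmom i

end Data

/-! ### Comparison of maximization problems -/

lemma MaxProblem.value_le_value {α β : Type*} {A : MaxProblem α} {B : MaxProblem β}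
    (h : ∀ a ∈ A.feasible, ∃ b ∈ B.feasible, A.objective a ≤ B.objective b) :
    A.value ≤ B.value := by
  refine iSup₂_le fun a ha => ?_
  obtain ⟨b, hb, hab⟩ := h a ha
  exact (EReal.coe_le_coe_iff.2 hab).trans
    (le_iSup₂ (f := fun b (_ : b ∈ B.feasible) => (B.objective b : EReal)) b hb)

/-- A feasible point that is at least as good as an optimal point of a problem dominating the given
one is optimal. -/
lemma MaxProblem.IsOptimal.transfer {α β : Type*} {A : MaxProblem α} {B : MaxProblem β} {a : α}
    (ha : A.IsOptimal a) {b : β} (hb : b ∈ B.feasible) (hab : A.objective a ≤ B.objective b)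
    (h : ∀ b ∈ B.feasible, ∃ a ∈ A.feasible, B.objective b ≤ A.objective a) : B.IsOptimal b := by
  refine ⟨hb, fun b' hb' => ?_⟩
  obtain ⟨a', ha', hle⟩ := h b' hb'
  exact (hle.trans (ha.2 a' ha')).trans hab

end POU
end

/-! ### Equivalence of the problems -/

theorem mainTheorem11 {m n : ℕ} (D : POU.Data m n) :
    -- fixed mass `c`
    (∀ c : ℝ, 0 < c → c ≤ 1 →
      -- the optimal values agree
      (D.dro c).value = (D.moment c).value ∧
      (D.moment c).value = (D.nlp c).value ∧
      -- feasible solutions of the DRO problem and of the moment problem correspond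
      (∀ P ∈ (D.dro c).feasible, ∃ Q ∈ (D.moment c).feasible, D.Recovers c Q P) ∧
      (∀ Q ∈ (D.moment c).feasible,
        (∃ P, D.Recovers c Q P) ∧
        ∀ P, D.Recovers c Q P →
          P ∈ (D.dro c).feasible ∧ (D.dro c).objective P = (D.moment c).objective Q) ∧
      -- feasible solutions of the nonlinear program and of the moment problem
      (∀ w ∈ (D.nlp c).feasible,
        POU.discrete w.1 w.2 ∈ (D.moment c).feasible ∧
        (D.moment c).objective (POU.discrete w.1 w.2) = (D.nlp c).objective w) ∧
      (∀ Q ∈ (D.moment c).feasible, ∃ w ∈ (D.nlp c).feasible,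
        (D.moment c).objective Q ≤ (D.nlp c).objective w) ∧
      -- optimal solutions
      (∀ Q, (D.moment c).IsOptimal Q → ∀ P, D.Recovers c Q P → (D.dro c).IsOptimal P) ∧
      (∀ P, (D.dro c).IsOptimal P → ∃ Q, (D.moment c).IsOptimal Q ∧ D.Recovers c Q P) ∧
      (∀ w, (D.nlp c).IsOptimal w → (D.moment c).IsOptimal (POU.discrete w.1 w.2)) ∧
      ((∃ Q, (D.moment c).IsOptimal Q) → ∃ w, (D.nlp c).IsOptimal w)) ∧
    -- mass between `l` and `u`
    (∀ l u : ℝ, u ≤ 1 →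
      (D.droRange l u).value = (D.nlpRange l u).value ∧
      (∀ c p z, (c, p, z) ∈ (D.nlpRange l u).feasible →
        (∃ P, D.Recovers c (POU.discrete p z) P) ∧
        ∀ P, D.Recovers c (POU.discrete p z) P →
          P ∈ (D.droRange l u).feasible ∧
          (D.droRange l u).objective P = (D.nlpRange l u).objective (c, p, z)) ∧
      (∀ P ∈ (D.droRange l u).feasible, ∃ p z,
        (P.real D.D₀, p, z) ∈ (D.nlpRange l u).feasible ∧
        (D.droRange l u).objective P ≤ (D.nlpRange l u).objective (P.real D.D₀, p, z)) ∧
      (∀ c p z, (D.nlpRange l u).IsOptimal (c, p, z) →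
        (∃ P, D.Recovers c (POU.discrete p z) P) ∧
        ∀ P, D.Recovers c (POU.discrete p z) P → (D.droRange l u).IsOptimal P) ∧
      (∀ P, (D.droRange l u).IsOptimal P →
        ∃ p z, (D.nlpRange l u).IsOptimal (P.real D.D₀, p, z))) := by
  -- the correspondences of feasible solutions at mass `c`
  have hto : ∀ c : ℝ, 0 < c → c ≤ 1 → ∀ Q ∈ (D.moment c).feasible,
      (∃ P, D.Recovers c Q P) ∧ ∀ P, D.Recovers c Q P →
        P ∈ (D.dro c).feasible ∧ (D.dro c).objective P = (D.moment c).objective Q := by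
    intro c hc hc1 Q hQ
    have hQp : MeasureTheory.IsProbabilityMeasure Q := hQ.1
    refine ⟨POU.Data.exists_recovers D hc.le hc1 Q hQ.2.1, fun P hP => ?_⟩
    obtain ⟨h1, h2, h3⟩ := hP.constraints hc hQ
    exact ⟨⟨hP.1, h1, h2⟩, h3⟩
  have hdisc : ∀ (c : ℝ) (w), w ∈ (D.nlp c).feasible →
      POU.discrete w.1 w.2 ∈ (D.moment c).feasible ∧
        (D.moment c).objective (POU.discrete w.1 w.2) = (D.nlp c).objective w := by
    intro c w hw
    exact ⟨POU.Data.NLPConstraints.moment_feasible hw,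
      congrArg (c * ·) (POU.Data.integral_discrete hw.2.2.2.1 _)⟩
  have hatoms : ∀ c : ℝ, 0 < c → ∀ Q ∈ (D.moment c).feasible, ∃ w ∈ (D.nlp c).feasible,
      (D.moment c).objective Q ≤ (D.nlp c).objective w := by
    intro c hc Q hQ
    obtain ⟨w, hw, hle⟩ := POU.Data.exists_nlp_of_moment hQ
    exact ⟨w, hw, mul_le_mul_of_nonneg_left hle hc.le⟩
  refine ⟨fun c hc hc1 => ?_, fun l u hu => ?_⟩
  · have hto := hto c hc hc1
    have hdisc := hdisc c
    have hatoms := hatoms c hc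
    have hfrom : ∀ P ∈ (D.dro c).feasible, ∃ Q ∈ (D.moment c).feasible, D.Recovers c Q P := by
      rintro P ⟨hP, hPc, hcon⟩
      have := hcon.exists_moment
      rwa [hPc] at this
    -- Mutual domination yields equal values, and lets optimality pass from a point to any
    -- corresponding feasible point.
    have dom₁ : ∀ P ∈ (D.dro c).feasible, ∃ Q ∈ (D.moment c).feasible,
        (D.dro c).objective P ≤ (D.moment c).objective Q := fun P hP => by
      obtain ⟨Q, hQ, hrec⟩ := hfrom P hP
      exact ⟨Q, hQ, ((hto Q hQ).2 P hrec).2.le⟩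
    have dom₂ : ∀ Q ∈ (D.moment c).feasible, ∃ P ∈ (D.dro c).feasible,
        (D.moment c).objective Q ≤ (D.dro c).objective P := fun Q hQ => by
      obtain ⟨⟨P, hP⟩, h⟩ := hto Q hQ
      exact ⟨P, (h P hP).1, (h P hP).2.ge⟩
    have dom₃ : ∀ w ∈ (D.nlp c).feasible, ∃ Q ∈ (D.moment c).feasible,
        (D.nlp c).objective w ≤ (D.moment c).objective Q := fun w hw =>
      ⟨_, (hdisc w hw).1, (hdisc w hw).2.ge⟩
    refine ⟨le_antisymm (POU.MaxProblem.value_le_value dom₁) (POU.MaxProblem.value_le_value dom₂),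
      le_antisymm (POU.MaxProblem.value_le_value hatoms) (POU.MaxProblem.value_le_value dom₃),
      hfrom, hto, hdisc, hatoms, fun Q hQ P hP => ?_, fun P hP => ?_, fun w hw => ?_, ?_⟩
    · have h := (hto Q hQ.1).2 P hP
      exact hQ.transfer h.1 h.2.ge dom₁
    · obtain ⟨Q, hQ, hrec⟩ := hfrom P hP.1
      exact ⟨Q, hP.transfer hQ ((hto Q hQ).2 P hrec).2.le dom₂, hrec⟩
    · exact hw.transfer (hdisc w hw.1).1 (hdisc w hw.1).2.ge hatoms
    · rintro ⟨Q, hQ⟩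
      obtain ⟨w, hw, hle⟩ := hatoms Q hQ.1
      exact ⟨w, hQ.transfer hw hle dom₃⟩
  · have hto' : ∀ c p z, (c, p, z) ∈ (D.nlpRange l u).feasible →
        (∃ P, D.Recovers c (POU.discrete p z) P) ∧
        ∀ P, D.Recovers c (POU.discrete p z) P → P ∈ (D.droRange l u).feasible ∧
          (D.droRange l u).objective P = (D.nlpRange l u).objective (c, p, z) := by
      rintro c p z ⟨hc, ⟨hl, hcu⟩, hcon⟩
      obtain ⟨hfeas, hobj⟩ := hdisc c (p, z) hcon
      obtain ⟨hex, hall⟩ := hto c hc (hcu.trans hu) _ hfeas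
      refine ⟨hex, fun P hP => ?_⟩
      obtain ⟨⟨h1, h2, h3⟩, h4⟩ := hall P hP
      exact ⟨⟨h1, by rw [h2]; exact ⟨hl, hcu⟩, h3⟩, h4.trans hobj⟩
    have hfrom' : ∀ P ∈ (D.droRange l u).feasible, ∃ p z,
        (P.real D.D₀, p, z) ∈ (D.nlpRange l u).feasible ∧
        (D.droRange l u).objective P ≤ (D.nlpRange l u).objective (P.real D.D₀, p, z) := by
      rintro P ⟨hP, ⟨hl, hPu⟩, hcon⟩
      -- The fixed-mass correspondence is applied at the mass of `P` itself.
      have hpos := hcon.real_pos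
      obtain ⟨Q, hQ, hrec⟩ := hcon.exists_moment
      obtain ⟨w, hw, hle⟩ := hatoms _ hpos Q hQ
      exact ⟨w.1, w.2, ⟨hpos, ⟨hl, hPu⟩, hw⟩,
        (((hto _ hpos (hPu.trans hu) Q hQ).2 P hrec).2.le).trans hle⟩
    have dom₁ : ∀ P ∈ (D.droRange l u).feasible, ∃ w ∈ (D.nlpRange l u).feasible,
        (D.droRange l u).objective P ≤ (D.nlpRange l u).objective w := fun P hP => by
      obtain ⟨p, z, h1, h2⟩ := hfrom' P hP
      exact ⟨_, h1, h2⟩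
    have dom₂ : ∀ w ∈ (D.nlpRange l u).feasible, ∃ P ∈ (D.droRange l u).feasible,
        (D.nlpRange l u).objective w ≤ (D.droRange l u).objective P := by
      rintro ⟨c, p, z⟩ hw
      obtain ⟨⟨P, hP⟩, h⟩ := hto' c p z hw
      exact ⟨P, (h P hP).1, (h P hP).2.ge⟩
    refine ⟨le_antisymm (POU.MaxProblem.value_le_value dom₁) (POU.MaxProblem.value_le_value dom₂),
      hto', hfrom', fun c p z hw => ?_, fun P hP => ?_⟩
    · obtain ⟨hex, hall⟩ := hto' c p z hw.1
      exact ⟨hex, fun P hP => hw.transfer (hall P hP).1 (hall P hP).2.ge dom₁⟩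
    · obtain ⟨p, z, h1, h2⟩ := hfrom' P hP.1
      exact ⟨p, z, hP.transfer h1 h2 dom₂⟩
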